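/- Let $M$ be a smooth manifold, $G$ a Lie group, $\pi\colon P\to M$ a smooth principal $G$-bundle with a principal connection, $V$ a finite-dimensional real $G$-module (with smooth action), and $P\times_G V=(P\times V)/G$ the associated vector bundle, where $(p,v)g=(pg,g^{-1}v)$. Manifolds are finite-dimensional, Hausdorff and without boundary. For $p\in P_x$ write $z\mapsto p\backslash z$ for the isomorphism $(P\times_G V)_x\to V$ inverse to $v\mapsto[p,v]$. For a vector field $X$ on $M$ let $X^H$ be its horizontal lift to $P$, and let $\nabla$ be the induced covariant derivative on $P\times_G V$: for a smooth section $s$, $p\backslash(\nabla_X s)(x)$ is the derivative at $p\in P_x$ of the function $q\mapsto q\backslash s(\pi(q))$ along $X^H$. For $\beta\in\Omega^k(M,P\times_G V)$, $k\ge 0$, the exterior covariant derivative is $$d^\nabla\beta(X_0,\dots,X_k)=\sum_{j=0}^k(-1)^j\nabla_{X_j}\bigl(\beta(X_0,\dots,\widehat{X_j},\dots,X_k)\bigr)+\sum_{i<j}(-1)^{i+j}\beta([X_i,X_j],X_0,\dots,\widehat{X_i},\dots,\widehat{X_j},\dots,X_k),$$ and $i_Z\beta=\beta(Z,\cdot,\dots,\cdot)$,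 with $i_Z\beta=0$ for $k=0$. Denote the flow of a vector field $X$ by $\Phi_X^t$. Regard $\beta$ as a bundle map $\Lambda^kTM\to P\times_G V$. The Darboux--Lie derivative of $\beta$ along a $G$-invariant vector field $\widetilde X$ on $P$ that projects onto the vector field $X$ on $M$ is the bundle map $\mathcal L_{\widetilde X}\beta\colon\Lambda^kTM\to P\times_G V$ with $$(\mathcal L_{\widetilde X}\beta)(y)=\Bigl[p,\ \tfrac{d}{dt}\Big|_{t=0}(\Phi_{\widetilde X}^t p)\backslash\beta\bigl(\Lambda^k(T_x\Phi_X^t)\,y\bigr)\Bigr]\qquad(y\in\Lambda^kT_xM,\ p\in P_x).$$ Then for every smooth vector field $Z$ on $M$ and every $\beta\in\Omega^k(M,P\times_G V)$: the horizontal lift $Z^H$ is a smooth $G$-invariant vector field on $P$ that projects onto $Z$; the derivative defining $\mathcal L_{Z^H}\beta$ exists, and its result is independent of $p$; $\mathcal L_{Z^H}\beta$ is again a $k$-form in $\Omega^k(M,P\times_G V)$; and $$\mathcal L_{Z^H}\beta=i_Z\,d^\nabla\beta+d^\nabla\, i_Z\beta .$$ That is, $\mathcal L_{Z^H}\beta$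 coincides with the covariant-Lie derivative $\mathcal L^\nabla_Z\beta:=i_Zd^\nabla\beta+d^\nabla i_Z\beta$; the identity means that both sides agree on all smooth vector fields $Y_1,\dots,Y_k$ on $M$. -/

import Mathlib

open scoped Manifold ContDiff

noncomputable section

namespace DarbouxLie

/-! ### Vector fields and flows -/

section Flow

/-- `𝔛(M)`: smooth vector fields on a smooth manifold `M` (without boundary) modelled on `E`. -/
abbrev SmoothVF (E : Type*) [NormedAddCommGroup E] [NormedSpace ℝ E]
    (M : Type*) [TopologicalSpace M] [ChartedSpace E M] [IsManifold 𝓘(ℝ, E) ∞ M] :=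
  ContMDiffSection 𝓘(ℝ, E) E ∞ (TangentSpace 𝓘(ℝ, E) : M → Type _)

variable {E : Type*} [NormedAddCommGroup E] [NormedSpace ℝ E]
  {M : Type*} [TopologicalSpace M] [ChartedSpace E M]

open Classical in
/-- `Φ_X^t (x)`: the value at time `t` of the integral curve of `X` starting at `x`.
If no integral curve starting at `x` is defined on an open interval containing `0` and `t`
(that is, if `(t, x)` is outside of the domain of the flow), the junk value is `x`. -/
def flow (X : ∀ x : M, TangentSpace 𝓘(ℝ, E) x) (t : ℝ) (x : M) : M :=
  if h : ∃ γ : ℝ → M, ∃ a b : ℝ, (0 : ℝ) ∈ Set.Ioo a b ∧ t ∈ Set.Ioo a b ∧ γ 0 = x ∧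
      IsMIntegralCurveOn γ X (Set.Ioo a b)
  then h.choose t else x

end Flow

/-! ### Principal bundles -/

/-- A smooth principal `G`-bundle `P → M` with its right action of `G`: every point of `M` has an
open neighbourhood `U` with a `G`-equivariant diffeomorphism `π⁻¹(U) → U × G` over `U`. -/
structure PrincipalBundle
    (F : Type*) [NormedAddCommGroup F] [NormedSpace ℝ F]
    (G : Type*) [TopologicalSpace G] [ChartedSpace F G] [Group G] [LieGroup 𝓘(ℝ, F) ∞ G]
    (E : Type*) [NormedAddCommGroup E] [NormedSpace ℝ E]
    (M : Type*) [TopologicalSpace M] [ChartedSpace E M] [IsManifold 𝓘(ℝ, E) ∞ M]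
    (B : Type*) [NormedAddCommGroup B] [NormedSpace ℝ B]
    (P : Type*) [TopologicalSpace P] [ChartedSpace B P] [IsManifold 𝓘(ℝ, B) ∞ P] where
  /-- the projection `π : P → M` -/
  proj : P → M
  /-- the right action `(p, g) ↦ p g` -/
  act : P → G → P
  act_one : ∀ p, act p 1 = p
  act_mul : ∀ p g h, act p (g * h) = act (act p g) h
  proj_act : ∀ p g, proj (act p g) = proj p
  smooth_proj : ContMDiff 𝓘(ℝ, B) 𝓘(ℝ, E) ∞ proj
  smooth_act : ContMDiff (𝓘(ℝ, B).prod 𝓘(ℝ, F)) 𝓘(ℝ, B) ∞ (fun q : P × G => act q.1 q.2)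
  locally_trivial : ∀ x : M, ∃ (U : Set M) (e : OpenPartialHomeomorph P (M × G)),
    IsOpen U ∧ x ∈ U ∧ e.source = proj ⁻¹' U ∧ e.target = U ×ˢ Set.univ ∧
    ContMDiffOn 𝓘(ℝ, B) (𝓘(ℝ, E).prod 𝓘(ℝ, F)) ∞ e e.source ∧
    ContMDiffOn (𝓘(ℝ, E).prod 𝓘(ℝ, F)) 𝓘(ℝ, B) ∞ e.symm e.target ∧
    (∀ p ∈ e.source, (e p).1 = proj p) ∧
    (∀ p ∈ e.source, ∀ g, e (act p g) = ((e p).1, (e p).2 * g))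

section Bundle

variable
  {F : Type*} [NormedAddCommGroup F] [NormedSpace ℝ F]
  {G : Type*} [TopologicalSpace G] [ChartedSpace F G] [Group G] [LieGroup 𝓘(ℝ, F) ∞ G]
  {E : Type*} [NormedAddCommGroup E] [NormedSpace ℝ E]
  {M : Type*} [TopologicalSpace M] [ChartedSpace E M] [IsManifold 𝓘(ℝ, E) ∞ M]
  {B : Type*} [NormedAddCommGroup B] [NormedSpace ℝ B]
  {P : Type*} [TopologicalSpace P] [ChartedSpace B P] [IsManifold 𝓘(ℝ, B) ∞ P]

namespace PrincipalBundle

/-- The fibre `P_x`. -/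
def Fiber (Q : PrincipalBundle F G E M B P) (x : M) : Type _ := {p : P // Q.proj p = x}

/-- A point of `P`, as a point of its fibre. -/
def self (Q : PrincipalBundle F G E M B P) (p : P) : Q.Fiber (Q.proj p) := ⟨p, rfl⟩

theorem existsUnique_act (Q : PrincipalBundle F G E M B P) (p q : P)
    (h : Q.proj p = Q.proj q) : ∃! g : G, Q.act p g = q := by
  obtain ⟨U, e, -, hx, hs, -, -, -, hfst, heq⟩ := Q.locally_trivial (Q.proj p)
  have hp : p ∈ e.source := by rw [hs]; exact hx
  have hq : q ∈ e.source := by rw [hs]; show Q.proj q ∈ U; rw [← h]; exact hx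
  have hact : ∀ g, Q.act p g ∈ e.source := fun g => by
    rw [hs]; show Q.proj (Q.act p g) ∈ U; rw [Q.proj_act]; exact hx
  refine ⟨(e p).2⁻¹ * (e q).2, ?_, ?_⟩
  · apply e.injOn (hact _) hq
    rw [heq p hp]
    ext
    · simp only [hfst p hp, hfst q hq, h]
    · simp
  · intro g hg
    have h1 := heq p hp g
    rw [hg] at h1
    rw [h1]; simp

theorem fiber_nonempty (Q : PrincipalBundle F G E M B P) (x : M) : Nonempty (Q.Fiber x) := by
  obtain ⟨U, e, -, hx, -, ht, -, -, hfst, -⟩ := Q.locally_trivial x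
  have hmem : ((x, 1) : M × G) ∈ e.target := by rw [ht]; exact ⟨hx, Set.mem_univ _⟩
  refine ⟨⟨e.symm (x, 1), ?_⟩⟩
  rw [← hfst _ (e.map_target hmem), e.right_inv hmem]

/-- Some point of the fibre `P_x`. -/
def point (Q : PrincipalBundle F G E M B P) (x : M) : Q.Fiber x :=
  Classical.choice (Q.fiber_nonempty x)

/-- `p \ q`, the unique `g ∈ G` such that `p g = q`, for `p` and `q` in the same fibre. -/
def div (Q : PrincipalBundle F G E M B P) {x : M} (p q : Q.Fiber x) : G :=
  (Q.existsUnique_act p.1 q.1 (p.2.trans q.2.symm)).choose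

theorem act_div (Q : PrincipalBundle F G E M B P) {x : M} (p q : Q.Fiber x) :
    Q.act p.1 (Q.div p q) = q.1 :=
  (Q.existsUnique_act p.1 q.1 (p.2.trans q.2.symm)).choose_spec.1

theorem div_eq (Q : PrincipalBundle F G E M B P) {x : M} (p q : Q.Fiber x) {g : G}
    (h : Q.act p.1 g = q.1) : Q.div p q = g :=
  (Q.existsUnique_act p.1 q.1 (p.2.trans q.2.symm)).unique (Q.act_div p q) h

theorem div_self (Q : PrincipalBundle F G E M B P) {x : M} (p : Q.Fiber x) : Q.div p p = 1 :=
  Q.div_eq p p (Q.act_one _)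

theorem div_mul_div (Q : PrincipalBundle F G E M B P) {x : M} (p q r : Q.Fiber x) :
    Q.div p q * Q.div q r = Q.div p r :=
  (Q.div_eq p r (by rw [Q.act_mul, Q.act_div, Q.act_div])).symm

/-- The vector field on `M` onto which a `G`-invariant vector field on `P` projects. -/
def base (Q : PrincipalBundle F G E M B P) (X : ∀ p : P, TangentSpace 𝓘(ℝ, B) p) (x : M) :
    TangentSpace 𝓘(ℝ, E) x :=
  (Q.point x).2 ▸ mfderiv 𝓘(ℝ, B) 𝓘(ℝ, E) Q.proj (Q.point x).1 (X (Q.point x).1)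

end PrincipalBundle

/-! ### The associated vector bundle `P ×_G V` of a `G`-module `V` -/

variable {V : Type*} [NormedAddCommGroup V] [NormedSpace ℝ V]

/-- The orbits in `P_x × V` of the action `(p, v) g = (p g, g⁻¹ v)`. -/
def assocSetoid (Q : PrincipalBundle F G E M B P) (ρ : Representation ℝ G V) (x : M) :
    Setoid (Q.Fiber x × V) where
  r a b := ∃ g : G, b.1.1 = Q.act a.1.1 g ∧ b.2 = ρ g⁻¹ a.2
  iseqv :=
    { refl := fun a => ⟨1, by simp [Q.act_one], by simp⟩
      symm := by
        rintro a b ⟨g, h1, h2⟩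
        refine ⟨g⁻¹, ?_, ?_⟩
        · rw [h1, ← Q.act_mul, mul_inv_cancel, Q.act_one]
        · rw [h2, inv_inv, ← Module.End.mul_apply, ← map_mul, mul_inv_cancel, map_one]; rfl
      trans := by
        rintro a b c ⟨g, h1, h2⟩ ⟨g', h1', h2'⟩
        refine ⟨g * g', ?_, ?_⟩
        · rw [h1', h1, Q.act_mul]
        · rw [h2', h2, ← Module.End.mul_apply, ← map_mul, mul_inv_rev] }

/-- The fibre over `x` of the associated bundle `P ×_G V = (P × V) / G`. -/
def Assoc (Q : PrincipalBundle F G E M B P) (ρ : Representation ℝ G V) (x : M) : Type _ :=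
  Quotient (assocSetoid Q ρ x)

namespace Assoc

variable {Q : PrincipalBundle F G E M B P} {ρ : Representation ℝ G V} {x : M}

/-- The class `[p, v]`. -/
def mk (p : Q.Fiber x) (v : V) : Assoc Q ρ x := Quotient.mk (assocSetoid Q ρ x) (p, v)

/-- `p \ [p', v] = (p \ p') v`. -/
def coord (p : Q.Fiber x) (z : Assoc Q ρ x) : V :=
  Quotient.lift (s := assocSetoid Q ρ x) (fun a => ρ (Q.div p a.1) a.2) (by
    rintro ⟨q, v⟩ ⟨q', v'⟩ ⟨g, h1, h2⟩
    have h3 : Q.div q q' = g := Q.div_eq q q' h1.symm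
    simp only at h2 ⊢
    rw [← Q.div_mul_div p q q', h3, h2, map_mul, Module.End.mul_apply,
      ← Module.End.mul_apply (ρ g), ← map_mul, mul_inv_cancel, map_one]
    rfl) z

theorem coord_mk (p q : Q.Fiber x) (v : V) :
    coord p (mk q v : Assoc Q ρ x) = ρ (Q.div p q) v := rfl

theorem mk_coord (p : Q.Fiber x) (z : Assoc Q ρ x) : mk p (coord p z) = z := by
  obtain ⟨⟨q, v⟩, rfl⟩ := Quotient.exists_rep z
  refine Quotient.sound (s := assocSetoid Q ρ x) ⟨Q.div p q, (Q.act_div p q).symm, ?_⟩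
  change v = ρ (Q.div p q)⁻¹ (ρ (Q.div p q) v)
  rw [← Module.End.mul_apply, ← map_mul, inv_mul_cancel, map_one]
  rfl

theorem coord_eq (p q : Q.Fiber x) (z : Assoc Q ρ x) :
    coord p z = ρ (Q.div p q) (coord q z) := by
  conv_lhs => rw [← mk_coord q z]
  exact coord_mk p q _

/-- The bijection `z ↦ p \ z` from the fibre over `x` to `V`, for `p ∈ P_x`. -/
def coordEquiv (p : Q.Fiber x) : Assoc Q ρ x ≃ V where
  toFun := coord p
  invFun := mk p
  left_inv := mk_coord p
  right_inv v := by rw [coord_mk, Q.div_self, map_one]; rfl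

instance : AddCommGroup (Assoc Q ρ x) := (coordEquiv (Q.point x)).addCommGroup

instance : Module ℝ (Assoc Q ρ x) := (coordEquiv (Q.point x)).module ℝ

/-- The vector space structure of the fibre is the one for which `z ↦ p \ z` is linear,
for every `p ∈ P_x`. -/
theorem coord_add (p : Q.Fiber x) (z w : Assoc Q ρ x) :
    coord p (z + w) = coord p z + coord p w := by
  have h : coord (Q.point x) (z + w) = coord (Q.point x) z + coord (Q.point x) w :=
    (coordEquiv (Q.point x)).apply_symm_apply _
  rw [coord_eq p (Q.point x) (z + w), h, map_add, ← coord_eq, ← coord_eq]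

theorem coord_smul (p : Q.Fiber x) (c : ℝ) (z : Assoc Q ρ x) :
    coord p (c • z) = c • coord p z := by
  have h : coord (Q.point x) (c • z) = c • coord (Q.point x) z :=
    (coordEquiv (Q.point x)).apply_symm_apply _
  rw [coord_eq p (Q.point x) (c • z), h, map_smul, ← coord_eq]

end Assoc

open Classical in
/-- `q \ z` for `q ∈ P` and `z` in the total space of `P ×_G V`; it is only meaningful, and
otherwise set to `0`, if `q` and `z` lie over the same point of `M`. -/
def totalCoord {Q : PrincipalBundle F G E M B P} {ρ : Representation ℝ G V}
    (q : P) (z : Σ x : M, Assoc Q ρ x) : V :=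
  if h : Q.proj q = z.1 then Assoc.coord (⟨q, h⟩ : Q.Fiber z.1) z.2 else 0

/-- The `G`-equivariant function `p ↦ p \ s(π(p))` on `P` of a section `s` of `P ×_G V`. -/
def sectionFun {Q : PrincipalBundle F G E M B P} {ρ : Representation ℝ G V}
    (s : ∀ x : M, Assoc Q ρ x) (p : P) : V :=
  Assoc.coord (Q.self p) (s (Q.proj p))

/-- Smoothness of a section of `P ×_G V`: in the local trivialisation `[σ(x), v] ↦ (x, v)` given by
a local section `σ` of `P`, the section `s` is `x ↦ σ(x) \ s(x)`; all of these are smooth if and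
only if `p ↦ p \ s(π(p))` is. -/
def IsSmoothSection {Q : PrincipalBundle F G E M B P} {ρ : Representation ℝ G V}
    (s : ∀ x : M, Assoc Q ρ x) : Prop :=
  ContMDiff 𝓘(ℝ, B) 𝓘(ℝ, V) ∞ (sectionFun s)

/-! ### Differential forms with values in `P ×_G V` -/

/-- `Ω^k(M, P ×_G V)`: families of alternating `k`-linear maps `(T_x M)^k → (P ×_G V)_x` that take
smooth vector fields to smooth sections. -/
structure AssocForm (Q : PrincipalBundle F G E M B P) (ρ : Representation ℝ G V) (k : ℕ) where
  /-- the value at a point -/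
  toFun : ∀ x : M, (TangentSpace 𝓘(ℝ, E) x) [⋀^Fin k]→ₗ[ℝ] Assoc Q ρ x
  smooth : ∀ Y : Fin k → SmoothVF E M, IsSmoothSection (fun x => toFun x (fun i => Y i x))

namespace AssocForm

variable {Q : PrincipalBundle F G E M B P} {ρ : Representation ℝ G V} {k : ℕ}

/-- A `k`-form as a fibrewise linear bundle map `Λ^k TM → P ×_G V`. -/
def bundleMap (β : AssocForm Q ρ k) (x : M) :
    ⋀[ℝ]^k (TangentSpace 𝓘(ℝ, E) x) →ₗ[ℝ] Assoc Q ρ x :=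
  exteriorPower.alternatingMapLinearEquiv (β.toFun x)

/-- The contraction `i_Z β`. -/
def interior (Z : SmoothVF E M) (β : AssocForm Q ρ (k + 1)) : AssocForm Q ρ k where
  toFun x := (β.toFun x).curryLeft (Z x)
  smooth Y := by
    have h := β.smooth (Matrix.vecCons Z Y)
    convert h using 3 with x
    rw [AlternatingMap.curryLeft_apply_apply]
    congr 1
    funext i
    refine Fin.cases ?_ (fun j => ?_) i <;> rfl

end AssocForm

/-! ### Principal connections, covariant derivative and exterior covariant derivative -/

/-- A principal connection on `P`, given by its horizontal lifts: a smooth `G`-equivariant right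
inverse of `Tπ : TP → π^* TM`. Its image is the horizontal distribution. -/
structure PrincipalConnection (Q : PrincipalBundle F G E M B P) where
  /-- the horizontal lift to `T_p P` of a vector tangent to `M` at `π(p)` -/
  lift : ∀ p : P, TangentSpace 𝓘(ℝ, E) (Q.proj p) →ₗ[ℝ] TangentSpace 𝓘(ℝ, B) p
  proj_lift : ∀ p v, mfderiv 𝓘(ℝ, B) 𝓘(ℝ, E) Q.proj p (lift p v) = v
  equivariant : ∀ (X : ∀ x : M, TangentSpace 𝓘(ℝ, E) x) (p : P) (g : G),
    lift (Q.act p g) (X (Q.proj (Q.act p g))) =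
      mfderiv 𝓘(ℝ, B) 𝓘(ℝ, B) (fun q => Q.act q g) p (lift p (X (Q.proj p)))
  smooth : ∀ X : SmoothVF E M, ContMDiff 𝓘(ℝ, B) 𝓘(ℝ, B).tangent ∞
    (fun p => (⟨p, lift p (X (Q.proj p))⟩ : TangentBundle 𝓘(ℝ, B) P))

namespace PrincipalConnection

variable {Q : PrincipalBundle F G E M B P} (A : PrincipalConnection Q)

/-- The horizontal lift `X^H` of a vector field `X` on `M`. -/
def horizontalLift (X : ∀ x : M, TangentSpace 𝓘(ℝ, E) x) (p : P) : TangentSpace 𝓘(ℝ, B) p :=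
  A.lift p (X (Q.proj p))

variable {ρ : Representation ℝ G V}

/-- The induced covariant derivative on `P ×_G V`: `p \ (∇_X s)(x)` is, for `p ∈ P_x`, the
derivative of the function `q ↦ q \ s(π(q))` along the horizontal lift of `X` at `p`. -/
def nabla (X : ∀ x : M, TangentSpace 𝓘(ℝ, E) x) (s : ∀ x : M, Assoc Q ρ x) (x : M) :
    Assoc Q ρ x :=
  Assoc.mk (Q.point x)
    (mfderiv 𝓘(ℝ, B) 𝓘(ℝ, V) (sectionFun s) (Q.point x).1
      (A.horizontalLift X (Q.point x).1))

/-- The part `∑_j (-1)^j ∇_{X_j} (β(X_0, …, X̂_j, …, X_k))` of the exterior covariant derivative. -/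
def dNablaFirst {k : ℕ} (β : AssocForm Q ρ k)
    (X : Fin (k + 1) → ∀ x : M, TangentSpace 𝓘(ℝ, E) x) (x : M) : Assoc Q ρ x :=
  ∑ j : Fin (k + 1), (-1 : ℝ) ^ (j : ℕ) •
    A.nabla (X j) (fun y => β.toFun y (fun i => j.removeNth X i y)) x

/-- The exterior covariant derivative
`d^∇ β (X_0, …, X_k) = ∑_j (-1)^j ∇_{X_j} (β(X_0, …, X̂_j, …, X_k))
  + ∑_{a < b} (-1)^{a + b} β([X_a, X_b], X_0, …, X̂_a, …, X̂_b, …, X_k)`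
as a section of `P ×_G V`. The second sum is empty for `k = 0`. For `k > 0` its terms are indexed by
`i ≤ j` in `Fin k`, where `a = i` and `b = j + 1`, which accounts for the minus sign. -/
def dNabla : {k : ℕ} → AssocForm Q ρ k →
    (Fin (k + 1) → ∀ x : M, TangentSpace 𝓘(ℝ, E) x) → ∀ x : M, Assoc Q ρ x
  | 0, β, X, x => A.dNablaFirst β X x
  | m + 1, β, X, x => A.dNablaFirst β X x -
      ∑ i : Fin (m + 1), ∑ j ∈ Finset.Ici i, (-1 : ℝ) ^ ((i : ℕ) + (j : ℕ)) •
        β.toFun x (Matrix.vecCons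
          (VectorField.mlieBracket 𝓘(ℝ, E) (X (Fin.castSucc i)) (X (Fin.succ j)) x)
          (fun l => j.removeNth ((Fin.castSucc i).removeNth X) l x))

/-- The covariant-Lie derivative `i_Z d^∇ β + d^∇ i_Z β`, evaluated on vector fields
`Y_1, …, Y_k`. For `k = 0` the form `i_Z β` is zero. -/
def covLie (Z : SmoothVF E M) : {k : ℕ} → AssocForm Q ρ k →
    (Fin k → ∀ x : M, TangentSpace 𝓘(ℝ, E) x) → ∀ x : M, Assoc Q ρ x
  | 0, β, Y, x => A.dNabla β (Matrix.vecCons Z Y) x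
  | _ + 1, β, Y, x => A.dNabla β (Matrix.vecCons Z Y) x + A.dNabla (β.interior Z) Y x

end PrincipalConnection

/-! ### The Darboux–Lie derivative -/

section Derivative

variable {Q : PrincipalBundle F G E M B P} {ρ : Representation ℝ G V} {k : ℕ}

/-- The flow on `Λ^k TM` of the canonical lift of a vector field `X` on `M`:
it maps `w ∈ Λ^k T_x M` to `Λ^k (T_x Φ_X^t) w`. -/
def liftedFlow (X : ∀ x : M, TangentSpace 𝓘(ℝ, E) x) (k : ℕ) (t : ℝ)
    (y : Σ x : M, ⋀[ℝ]^k (TangentSpace 𝓘(ℝ, E) x)) : Σ x : M, ⋀[ℝ]^k (TangentSpace 𝓘(ℝ, E) x) :=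
  ⟨flow X t y.1,
    exteriorPower.map k (mfderiv 𝓘(ℝ, E) 𝓘(ℝ, E) (flow X t) y.1).toLinearMap y.2⟩

/-- The curve `t ↦ (Φ_X^t p) \ h(Φ^t y)` in `V`, where `X` is a `G`-invariant vector field on `P`
and `Φ^t` is the flow on `Λ^k TM` of the canonical lift of the projection of `X` to `M`. -/
def darbouxLieCurve (X : ∀ p : P, TangentSpace 𝓘(ℝ, B) p)
    (h : ∀ x : M, ⋀[ℝ]^k (TangentSpace 𝓘(ℝ, E) x) → Assoc Q ρ x) (p : P)
    (y : Σ x : M, ⋀[ℝ]^k (TangentSpace 𝓘(ℝ, E) x)) (t : ℝ) : V :=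
  totalCoord (Q := Q) (ρ := ρ) (flow X t p)
    (Sigma.map id h (liftedFlow (Q.base X) k t y))

/-- The Darboux–Lie derivative along a `G`-invariant vector field `X` on `P` of a bundle map
`h : Λ^k TM → P ×_G V`. Let `X_V` be the vector field on `P ×_G V` with the flow
`[q, v] ↦ [Φ_X^t q, v]`. At `y ∈ Λ^k T_x M` the vertical vector `Th(F(X)_y) - (X_V)_{h(y)}` is the
velocity at `t = 0` of the curve `t ↦ Φ_{X_V}^{-t}(h(Φ^t y)) = [p, (Φ_X^t p) \ h(Φ^t y)]` in the
vector space `(P ×_G V)_x`, for any `p ∈ P_x`; here `F(X)` is the canonical lift with flow `Φ^t`.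
(For the chosen `p`: `h(Φ^t y) = [Φ_X^t p, v(t)]` with `v` the curve `darbouxLieCurve`, while
`X_V` at `h(y)` is the velocity of `[Φ_X^t p, v(0)]`, so that the difference is `[p, v'(0)]`.) -/
def darbouxLie (X : ∀ p : P, TangentSpace 𝓘(ℝ, B) p)
    (h : ∀ x : M, ⋀[ℝ]^k (TangentSpace 𝓘(ℝ, E) x) → Assoc Q ρ x) (x : M)
    (w : ⋀[ℝ]^k (TangentSpace 𝓘(ℝ, E) x)) : Assoc Q ρ x :=
  Assoc.mk (Q.point x) (deriv (darbouxLieCurve X h (Q.point x).1 ⟨x, w⟩) 0)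

end Derivative

end Bundle

end DarbouxLie

end

/-! Both sides equal `covLieFormula`, the section ∇_Z(β(Y_1, …, Y_k)) − ∑_i β(Y_1, …, [Z, Y_i], …,
Y_k).

For the Darboux–Lie derivative, let q(t) be the integral curve of Z^H through p; it covers the flow
of Z. The curve to differentiate, q(t) \ β(TΦ^t Y_i(x)), is compared with q(t) \ β(Y_i(Φ^t x)),
whose derivative is p \ ∇_Z(β(Y)) by definition of ∇. At t = 0 the two have the same arguments, so
in the derivative of their difference the variation of β cancels and only the velocities of the
arguments matter. In the chart at x these are DZ(Y_i) and DY_i(Z), which differ by −[Z, Y_i]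
(`hasDerivAt_multilinear_sub`, `mlieBracket_eq_chartField`). The velocity of TΦ^t at t = 0 comes
from the variational equation (`exists_flow_hasFDerivAt`, `exists_flow_chart`). This settles
decomposable k-vectors (`hasDerivAt_darbouxLieCurve_ιMulti`). They span Λ^k T_xM and the curve is
linear in the k-vector, so existence of the derivative, independence of p and linearity follow for
all k-vectors.

For i_Z d^∇ β + d^∇ i_Z β, the identity is Cartan's formula (`covLie_eq_covLieFormula`): the terms
in which Z is neither differentiated along nor bracketed appear in both summands with opposite
signs. -/

/-! ### Local flows in a normed space and their derivative in the initial value. -/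

open Filter Set Metric Topology in
/-- Two-sided Grönwall estimate for a curve starting at `0`. -/
theorem norm_le_gronwallBound_abs {E : Type*} [NormedAddCommGroup E] [NormedSpace ℝ E]
    {e e' : ℝ → E} {r K δ : ℝ} (he : ∀ t ∈ Ioo (-r) r, HasDerivAt e (e' t) t) (h0 : e 0 = 0)
    (hb : ∀ t ∈ Ioo (-r) r, ‖e' t‖ ≤ K * ‖e t‖ + δ) :
    ∀ t ∈ Ioo (-r) r, ‖e t‖ ≤ gronwallBound 0 K δ |t| := by
  have key : ∀ (f f' : ℝ → E), (∀ t ∈ Ioo (-r) r, HasDerivAt f (f' t) t) → f 0 = 0 →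
      (∀ t ∈ Ioo (-r) r, ‖f' t‖ ≤ K * ‖f t‖ + δ) →
      ∀ t ∈ Ioo (-r) r, 0 ≤ t → ‖f t‖ ≤ gronwallBound 0 K δ t := by
    intro f f' hf hf0 hfb t ht ht0
    have hsub : ∀ s ∈ Icc 0 t, s ∈ Ioo (-r) r := fun s hs =>
      ⟨by linarith [hs.1, hs.2, ht.1, ht.2], by linarith [hs.2, ht.2]⟩
    have := norm_le_gronwallBound_of_norm_deriv_right_le (f := f) (f' := f') (δ := 0) (K := K)
      (ε := δ) (a := 0) (b := t)
      (fun s hs => (hf s (hsub s hs)).continuousAt.continuousWithinAt)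
      (fun s hs => (hf s (hsub s (Ico_subset_Icc_self hs))).hasDerivWithinAt)
      (by simp [hf0]) (fun s hs => hfb s (hsub s (Ico_subset_Icc_self hs))) t ⟨ht0, le_rfl⟩
    simpa using this
  intro t ht
  rcases le_total 0 t with h | h
  · rw [abs_of_nonneg h]; exact key e e' he h0 hb t ht h
  · rw [abs_of_nonpos h]
    have hneg : ∀ s ∈ Ioo (-r) r, -s ∈ Ioo (-r) r := fun s hs =>
      ⟨by linarith [hs.2], by linarith [hs.1]⟩
    have := key (fun s => e (-s)) (fun s => -e' (-s))
      (fun s hs => by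
        have := (he (-s) (hneg s hs)).scomp s (hasDerivAt_neg s)
        simpa [Function.comp_def] using this)
      (by simpa using h0) (fun s hs => by simpa using hb (-s) (hneg s hs)) (-t) (hneg t ht)
      (by linarith)
    simpa using this

open Filter Set Metric Topology in
/-- A `C²` vector field has a local flow which is differentiable in the initial value at the
centre, with a derivative whose velocity at time `0` is the derivative of the vector field. -/
theorem exists_flow_hasFDerivAt {E : Type*} [NormedAddCommGroup E] [NormedSpace ℝ E]
    [CompleteSpace E] {f : E → E} {x₀ : E} (hf : ContDiffAt ℝ 2 f x₀) {U : Set E}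
    (hU : U ∈ 𝓝 x₀) :
    ∃ r > (0 : ℝ), ∃ ε > (0 : ℝ), ∃ (α : E → ℝ → E) (J : ℝ → E →L[ℝ] E),
      (∀ y ∈ ball x₀ r, α y 0 = y ∧ ∀ t ∈ Ioo (-ε) ε, HasDerivAt (α y) (f (α y t)) t ∧ α y t ∈ U) ∧
      (∀ t ∈ Ioo (-ε) ε, HasFDerivAt (fun y => α y t) (J t) x₀) ∧
      J 0 = ContinuousLinearMap.id ℝ E ∧ HasDerivAt J (fderiv ℝ f x₀) 0 := by
  set g : E → E →L[ℝ] E := fderiv ℝ f with hg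
  have hg1 : ContDiffAt ℝ 1 g x₀ := hf.fderiv_right (by norm_num)
  -- a ball on which the vector field and its derivative are controlled
  obtain ⟨K, s, hs, hK⟩ := hg1.exists_lipschitzOnWith
  have hbd : ∀ᶠ y in 𝓝 x₀, ‖g y‖ < ‖g x₀‖ + 1 :=
    hg1.continuousAt.norm.eventually_lt continuousAt_const (by simp)
  have hdiff : ∀ᶠ y in 𝓝 x₀, DifferentiableAt ℝ f y :=
    (hf.eventually (by simp)).mono fun y hy => hy.differentiableAt (by norm_num)
  obtain ⟨R, hR, hball⟩ := Metric.eventually_nhds_iff_ball.1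
    ((hbd.and hdiff).and (Filter.inter_mem hs hU))
  set C := ‖g x₀‖ + 1 with hC
  have hCpos : 0 < C := by positivity
  -- Second-order Taylor bound: the mean value inequality for `f - g z` on the segment from `z` to
  -- `y`, where the Lipschitz bound on `g` controls the derivative.
  have hquad : ∀ y ∈ ball x₀ R, ∀ z ∈ ball x₀ R,
      ‖f y - f z - g z (y - z)‖ ≤ K * ‖y - z‖ * ‖y - z‖ := by
    intro y hy z hz
    have hseg : segment ℝ z y ⊆ ball x₀ R := (convex_ball x₀ R).segment_subset hz hy
    refine (convex_segment z y).norm_image_sub_le_of_norm_fderiv_le' (𝕜 := ℝ)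
      (fun w hw => (hball w (hseg hw)).1.2) (fun w hw => ?_) (left_mem_segment ℝ z y)
      (right_mem_segment ℝ z y)
    refine (hK.norm_sub_le (hball w (hseg hw)).2.1 (hball z hz).2.1).trans ?_
    gcongr
    obtain ⟨θ, hθ, rfl⟩ := (segment_eq_image' ℝ z y) ▸ hw
    simp only [add_sub_cancel_left, norm_smul, Real.norm_eq_abs, abs_of_nonneg hθ.1]
    exact mul_le_of_le_one_left (norm_nonneg _) hθ.2
  -- the flow of the first-order variational system
  set S : E × (E →L[ℝ] E) → E × (E →L[ℝ] E) := fun q => (f q.1, (g q.1).comp q.2) with hS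
  -- Since `f` is C², `S` is C¹, which is enough for Picard–Lindelöf with Lipschitz dependence on
  -- the initial value.
  have hSc : ContDiffAt ℝ 1 S (x₀, ContinuousLinearMap.id ℝ E) := by
    refine ContDiffAt.prodMk ?_ ?_
    · exact (hf.of_le (by norm_num)).comp (x₀, ContinuousLinearMap.id ℝ E) contDiffAt_fst
    · exact ContDiffAt.clm_comp (hg1.comp (x₀, ContinuousLinearMap.id ℝ E) contDiffAt_fst)
        contDiffAt_snd
  obtain ⟨ε, hε, a, r, _, _, hr, hpl⟩ := IsPicardLindelof.of_contDiffAt_one hSc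
  obtain ⟨Ψ, hΨ, L, hL⟩ :=
    (hpl 0).exists_forall_mem_closedBall_eq_hasDerivWithinAt_lipschitzOnWith
  simp only [zero_sub, zero_add] at hΨ hL
  have hr' : (0 : ℝ) < r := hr
  have hmem : ∀ y ∈ ball x₀ (r : ℝ),
      ((y, ContinuousLinearMap.id ℝ E) : E × (E →L[ℝ] E)) ∈
        closedBall (x₀, ContinuousLinearMap.id ℝ E) (r : ℝ) := by
    intro y hy
    rw [mem_closedBall, Prod.dist_eq, dist_self]
    exact max_le (mem_ball.1 hy).le hr'.le
  have hx₀ : x₀ ∈ ball x₀ (r : ℝ) := mem_ball_self hr'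
  set α : E → ℝ → E := fun y t => (Ψ (y, ContinuousLinearMap.id ℝ E) t).1 with hα
  set J : ℝ → E →L[ℝ] E := fun t => (Ψ (x₀, ContinuousLinearMap.id ℝ E) t).2 with hJ
  have hder : ∀ y ∈ ball x₀ (r : ℝ), ∀ t ∈ Ioo (-ε) ε,
      HasDerivAt (Ψ (y, ContinuousLinearMap.id ℝ E)) (S (Ψ (y, ContinuousLinearMap.id ℝ E) t)) t :=
    fun y hy t ht => ((hΨ _ (hmem y hy)).2 t (Ioo_subset_Icc_self ht)).hasDerivAt
      (Icc_mem_nhds ht.1 ht.2)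
  have hαd : ∀ y ∈ ball x₀ (r : ℝ), ∀ t ∈ Ioo (-ε) ε, HasDerivAt (α y) (f (α y t)) t :=
    fun y hy t ht => (hder y hy t ht).fst
  have hJd : ∀ t ∈ Ioo (-ε) ε, HasDerivAt J ((g (α x₀ t)).comp (J t)) t :=
    fun t ht => (hder x₀ hx₀ t ht).snd
  have hα0 : ∀ y ∈ ball x₀ (r : ℝ), α y 0 = y := fun y hy => by
    simp only [hα, (hΨ _ (hmem y hy)).1]
  have hJ0 : J 0 = ContinuousLinearMap.id ℝ E := by simp only [hJ, (hΨ _ (hmem x₀ hx₀)).1]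
  have hLip : ∀ y ∈ ball x₀ (r : ℝ), ∀ t ∈ Ioo (-ε) ε, ‖α y t - α x₀ t‖ ≤ L * ‖y - x₀‖ := by
    intro y hy t ht
    have h1 := (hL t (Ioo_subset_Icc_self ht)).dist_le_mul _ (hmem y hy) _ (hmem x₀ hx₀)
    rw [Prod.dist_eq, Prod.dist_eq (x := (y, _)), dist_self, max_eq_left dist_nonneg] at h1
    simpa only [← dist_eq_norm] using (le_max_left _ _).trans h1
  have h0mem : (0 : ℝ) ∈ Ioo (-ε) ε := ⟨by linarith, hε⟩
  -- shrink space and time so that the flow stays in the ball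
  have hcont : ContinuousAt (α x₀) 0 := (hαd x₀ hx₀ 0 h0mem).continuousAt
  obtain ⟨ε₁, hε₁, hε₁'⟩ := Metric.continuousAt_iff.1 hcont (R / 2) (by positivity)
  set ε₂ := min ε ε₁ with hε₂
  -- The Lipschitz spread `L * ‖y - x₀‖` then uses at most half of `R`, and the central trajectory
  -- less than the other half; `L + 1` avoids division by zero.
  set r₂ := min (r : ℝ) (R / 2 / (L + 1)) with hr₂
  have hr₂pos : 0 < r₂ := by positivity
  have hsub : ∀ t ∈ Ioo (-ε₂) ε₂, t ∈ Ioo (-ε) ε := fun t ht =>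
    ⟨by linarith [ht.1, min_le_left ε ε₁], ht.2.trans_le (min_le_left _ _)⟩
  have hstay : ∀ y ∈ ball x₀ r₂, ∀ t ∈ Ioo (-ε₂) ε₂, α y t ∈ ball x₀ R := by
    intro y hy t ht
    have h1 := hLip y (ball_subset_ball (min_le_left _ _) hy) t (hsub t ht)
    have h2 : dist (α x₀ t) x₀ < R / 2 := by
      have := @hε₁' t (by
        rw [dist_zero_right, Real.norm_eq_abs, abs_lt]
        exact ⟨by linarith [ht.1, min_le_right ε ε₁], ht.2.trans_le (min_le_right _ _)⟩)
      rwa [hα0 x₀ hx₀] at this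
    have h3 : ‖y - x₀‖ ≤ R / 2 / (L + 1) := by
      rw [← dist_eq_norm]; exact ((mem_ball.1 hy).trans_le (min_le_right _ _)).le
    have h4 : (L : ℝ) * ‖y - x₀‖ ≤ R / 2 := by
      calc (L : ℝ) * ‖y - x₀‖ ≤ (L + 1) * (R / 2 / (L + 1)) := by gcongr; linarith
        _ = R / 2 := by field_simp
    rw [mem_ball]
    calc dist (α y t) x₀ ≤ dist (α y t) (α x₀ t) + dist (α x₀ t) x₀ := dist_triangle _ _ _
      _ < R / 2 + R / 2 := by rw [dist_eq_norm (α y t)]; linarith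
      _ = R := by ring
  have hx₂ : x₀ ∈ ball x₀ r₂ := mem_ball_self hr₂pos
  refine ⟨r₂, hr₂pos, ε₂, lt_min hε hε₁, α, J, fun y hy => ?_, fun t ht => ?_, hJ0, ?_⟩
  · have hy' := ball_subset_ball (min_le_left _ _) hy
    exact ⟨hα0 y hy', fun t ht => ⟨hαd y hy' t (hsub t ht), (hball _ (hstay y hy t ht)).2.2⟩⟩
  -- The linearisation error e satisfies ‖e'‖ ≤ C‖e‖ + K(L‖y − x₀‖)² and vanishes at time 0, so
  -- Grönwall makes it quadratic in ‖y − x₀‖.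
  · have hquad' : ∀ y ∈ ball x₀ r₂, ‖α y t - α x₀ t - J t (y - x₀)‖ ≤
        (K * L * L * gronwallBound 0 C 1 |t|) * ‖y - x₀‖ ^ 2 := by
      intro y hy
      have hy' := ball_subset_ball (min_le_left _ _) hy
      have h := norm_le_gronwallBound_abs (r := ε₂) (K := C) (δ := K * (L * ‖y - x₀‖) ^ 2)
        (e := fun t => α y t - α x₀ t - J t (y - x₀))
        (e' := fun t => f (α y t) - f (α x₀ t) - (g (α x₀ t)).comp (J t) (y - x₀))
        (fun t ht => ((hαd y hy' t (hsub t ht)).sub (hαd x₀ hx₀ t (hsub t ht))).sub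
          ((hJd t (hsub t ht)).clm_apply (hasDerivAt_const t (y - x₀)) |>.congr_deriv (by simp)))
        (by simp [hα0 y hy', hα0 x₀ hx₀, hJ0]) (fun t ht => ?_) t ht
      · refine h.trans (le_of_eq ?_)
        simp only [gronwallBound_of_K_ne_0 hCpos.ne']
        ring
      · have h1 := hquad _ (hstay y hy t ht) _ (hstay x₀ hx₂ t ht)
        have h2 := hLip y hy' t (hsub t ht)
        have h3 : ‖g (α x₀ t)‖ ≤ C := (hball _ (hstay x₀ hx₂ t ht)).1.1.le
        have h4 : f (α y t) - f (α x₀ t) - (g (α x₀ t)).comp (J t) (y - x₀) =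
            (f (α y t) - f (α x₀ t) - g (α x₀ t) (α y t - α x₀ t)) +
              g (α x₀ t) (α y t - α x₀ t - J t (y - x₀)) := by
          simp only [map_sub, ContinuousLinearMap.comp_apply]; abel
        rw [h4, add_comm]
        refine (norm_add_le _ _).trans (add_le_add ?_ (h1.trans ?_))
        · exact (ContinuousLinearMap.le_opNorm _ _).trans (by gcongr)
        · rw [mul_assoc, ← sq]; gcongr
    rw [hasFDerivAt_iff_isLittleO]
    refine Asymptotics.IsBigO.trans_isLittleO (g := fun y => ‖y - x₀‖ ^ 2) ?_ ?_
    · refine Asymptotics.IsBigO.of_bound (K * L * L * gronwallBound 0 C 1 |t|) ?_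
      filter_upwards [ball_mem_nhds x₀ hr₂pos] with y hy
      simpa using hquad' y hy
    · have : Tendsto (fun y => y - x₀) (𝓝 x₀) (𝓝 0) := tendsto_sub_nhds_zero_iff.2 tendsto_id
      exact (Asymptotics.isLittleO_norm_pow_id (E' := E) one_lt_two).comp_tendsto this
  · have h := hJd 0 h0mem
    rwa [hα0 x₀ hx₀, hJ0, ContinuousLinearMap.comp_id] at h

namespace DarbouxLie

/-! ### Flows and Lie brackets in the chart at a point. -/

section FlowBasic

variable {E : Type*} [NormedAddCommGroup E] [NormedSpace ℝ E]
  {M : Type*} [TopologicalSpace M] [ChartedSpace E M]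

/-- Any integral curve starting at `x` computes the flow. -/
theorem flow_eq [IsManifold 𝓘(ℝ, E) 1 M] [T2Space M] {X : ∀ x : M, TangentSpace 𝓘(ℝ, E) x}
    (hX : ContMDiff 𝓘(ℝ, E) 𝓘(ℝ, E).tangent 1 (fun x => (⟨x, X x⟩ : TangentBundle 𝓘(ℝ, E) M)))
    {γ : ℝ → M} {a b : ℝ} (hγ : IsMIntegralCurveOn γ X (Set.Ioo a b)) (h0 : (0 : ℝ) ∈ Set.Ioo a b)
    {t : ℝ} (ht : t ∈ Set.Ioo a b) : flow X t (γ 0) = γ t := by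
  have h : ∃ δ : ℝ → M, ∃ c d : ℝ, (0 : ℝ) ∈ Set.Ioo c d ∧ t ∈ Set.Ioo c d ∧ δ 0 = γ 0 ∧
      IsMIntegralCurveOn δ X (Set.Ioo c d) := ⟨γ, a, b, h0, ht, rfl, hγ⟩
  rw [flow, dif_pos h]
  obtain ⟨c, d, hc0, hct, hδ0, hδ⟩ := h.choose_spec
  -- The chosen curve and `γ` may live on different intervals; uniqueness of integral curves is
  -- applied on the intersection.
  have hmax : ∀ s, s ∈ Set.Ioo a b → s ∈ Set.Ioo c d → s ∈ Set.Ioo (max a c) (min b d) :=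
    fun s h1 h2 => ⟨max_lt h1.1 h2.1, lt_min h1.2 h2.2⟩
  exact isMIntegralCurveOn_Ioo_eqOn_of_contMDiff_boundaryless (hmax 0 h0 hc0) hX
    (hδ.mono (Set.Ioo_subset_Ioo (le_max_right _ _) (min_le_right _ _)))
    (hγ.mono (Set.Ioo_subset_Ioo (le_max_left _ _) (min_le_left _ _))) hδ0 (hmax t ht hct)

variable (M) in
/-- The expression of a vector field in the chart at `x₀`. -/
noncomputable def chartField (x₀ : M) (X : ∀ x : M, TangentSpace 𝓘(ℝ, E) x) : E → E :=
  VectorField.mpullbackWithin 𝓘(ℝ, E) 𝓘(ℝ, E) (extChartAt 𝓘(ℝ, E) x₀).symm X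
    (Set.range 𝓘(ℝ, E))

variable [IsManifold 𝓘(ℝ, E) 1 M]

theorem chartField_apply {x₀ : M} {X : ∀ x : M, TangentSpace 𝓘(ℝ, E) x} {z : E}
    (hz : z ∈ (extChartAt 𝓘(ℝ, E) x₀).target) :
    chartField M x₀ X z = mfderiv 𝓘(ℝ, E) 𝓘(ℝ, E) (extChartAt 𝓘(ℝ, E) x₀)
      ((extChartAt 𝓘(ℝ, E) x₀).symm z) (X ((extChartAt 𝓘(ℝ, E) x₀).symm z)) := by
  have h1 := mfderiv_extChartAt_comp_mfderivWithin_extChartAt_symm (I := 𝓘(ℝ, E)) hz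
  have h2 := mfderivWithin_extChartAt_symm_comp_mfderiv_extChartAt (I := 𝓘(ℝ, E)) hz
  change (mfderivWithin 𝓘(ℝ, E) 𝓘(ℝ, E) (extChartAt 𝓘(ℝ, E) x₀).symm
    (Set.range 𝓘(ℝ, E)) z).inverse _ = _
  rw [ContinuousLinearMap.inverse_eq h2 h1]
  rfl

theorem chartField_extChartAt {x₀ y : M} {X : ∀ x : M, TangentSpace 𝓘(ℝ, E) x}
    (hy : y ∈ (extChartAt 𝓘(ℝ, E) x₀).source) :
    chartField M x₀ X (extChartAt 𝓘(ℝ, E) x₀ y) =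
      mfderiv 𝓘(ℝ, E) 𝓘(ℝ, E) (extChartAt 𝓘(ℝ, E) x₀) y (X y) := by
  rw [chartField_apply ((extChartAt 𝓘(ℝ, E) x₀).map_source hy)]
  rw [(extChartAt 𝓘(ℝ, E) x₀).left_inv hy]

theorem chartField_self {x₀ : M} {X : ∀ x : M, TangentSpace 𝓘(ℝ, E) x} :
    chartField M x₀ X (extChartAt 𝓘(ℝ, E) x₀ x₀) = X x₀ := by
  rw [chartField_extChartAt (mem_extChartAt_source _), mfderiv_extChartAt_self]
  rfl

theorem contDiffAt_chartField [CompleteSpace E] [IsManifold 𝓘(ℝ, E) ∞ M] {x₀ : M}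
    {X : ∀ x : M, TangentSpace 𝓘(ℝ, E) x}
    (hX : ContMDiff 𝓘(ℝ, E) 𝓘(ℝ, E).tangent ∞ (fun x => (⟨x, X x⟩ : TangentBundle 𝓘(ℝ, E) M))) :
    ContDiffAt ℝ 2 (chartField M x₀ X) (extChartAt 𝓘(ℝ, E) x₀ x₀) := by
  have h2 : (2 : WithTop ℕ∞) ≤ ∞ := by norm_cast
  have h := VectorField.contMDiffWithinAt_mpullbackWithin_extChartAt_symm (I := 𝓘(ℝ, E)) (n := ∞)
    (m := 2) (s := Set.univ) ((hX x₀).of_le h2).contMDiffWithinAt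
    uniqueMDiffOn_univ (Set.mem_univ x₀) (by norm_cast)
  rw [Set.preimage_univ, Set.inter_univ] at h
  have h2 := h.contMDiffAt (extChartAt_target_mem_nhds x₀)
  rw [contMDiffAt_vectorSpace_iff_contDiffAt] at h2
  exact h2

theorem hasMFDerivAt_symm_chart_curve {x₀ : M} {X : ∀ x : M, TangentSpace 𝓘(ℝ, E) x} {α : ℝ → E}
    {t : ℝ} (hα : HasDerivAt α (chartField M x₀ X (α t)) t)
    (ht : α t ∈ (extChartAt 𝓘(ℝ, E) x₀).target) :
    HasMFDerivAt 𝓘(ℝ, ℝ) 𝓘(ℝ, E) (fun s => (extChartAt 𝓘(ℝ, E) x₀).symm (α s)) t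
      ((1 : ℝ →L[ℝ] ℝ).smulRight (X ((extChartAt 𝓘(ℝ, E) x₀).symm (α t)))) := by
  have h1 : HasMFDerivAt 𝓘(ℝ, E) 𝓘(ℝ, E) (extChartAt 𝓘(ℝ, E) x₀).symm (α t)
      (mfderivWithin 𝓘(ℝ, E) 𝓘(ℝ, E) (extChartAt 𝓘(ℝ, E) x₀).symm (Set.range 𝓘(ℝ, E)) (α t)) :=
    (mdifferentiableWithinAt_extChartAt_symm (I := 𝓘(ℝ, E)) ht).hasMFDerivWithinAt.hasMFDerivAt
      (by simp)
  refine (h1.comp t hα.hasFDerivAt.hasMFDerivAt).congr_mfderiv ?_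
  have h2 := mfderivWithin_extChartAt_symm_comp_mfderiv_extChartAt (I := 𝓘(ℝ, E)) ht
  rw [chartField_apply ht]
  have h3 := congrArg (fun L => L (X ((extChartAt 𝓘(ℝ, E) x₀).symm (α t)))) h2
  refine ContinuousLinearMap.ext fun s => ?_
  exact (map_smul (mfderivWithin 𝓘(ℝ, E) 𝓘(ℝ, E) (extChartAt 𝓘(ℝ, E) x₀).symm
    (Set.range 𝓘(ℝ, E)) (α t)) (show ℝ from s) _).trans (congrArg (fun w : E => (show ℝ from s) • w) h3)

/-- The derivative at `x` of the chart centred at `x` is the identity, so the pullback in the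
definition of the bracket disappears there. -/
theorem mlieBracket_eq_chartField {x : M} (X Y : ∀ x : M, TangentSpace 𝓘(ℝ, E) x) :
    VectorField.mlieBracket 𝓘(ℝ, E) X Y x =
      fderiv ℝ (chartField M x Y) (extChartAt 𝓘(ℝ, E) x x) (X x) -
        fderiv ℝ (chartField M x X) (extChartAt 𝓘(ℝ, E) x x) (Y x) := by
  have hinv : (show E →L[ℝ] E from
      mfderiv 𝓘(ℝ, E) 𝓘(ℝ, E) (extChartAt 𝓘(ℝ, E) x) x).inverse = ContinuousLinearMap.id ℝ E := by
    have : (show E →L[ℝ] E from mfderiv 𝓘(ℝ, E) 𝓘(ℝ, E) (extChartAt 𝓘(ℝ, E) x) x) =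
      ContinuousLinearMap.id ℝ E := mfderiv_extChartAt_self
    rw [this, ContinuousLinearMap.inverse_id]
  rw [← VectorField.mlieBracketWithin_univ, VectorField.mlieBracketWithin_apply]
  refine (congrArg (fun L : E →L[ℝ] E => L _) hinv).trans ?_
  change VectorField.lieBracketWithin ℝ (chartField M x X) (chartField M x Y)
    ((extChartAt 𝓘(ℝ, E) x).symm ⁻¹' Set.univ ∩ Set.range 𝓘(ℝ, E)) (extChartAt 𝓘(ℝ, E) x x) = _
  rw [Set.preimage_univ, Set.univ_inter, modelWithCornersSelf_coe, Set.range_id,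
    VectorField.lieBracketWithin_univ, VectorField.lieBracket, chartField_self, chartField_self]

-- Transfers the variational equation to the manifold: `J t` is TΦ^t at `x`, read in the chart at
-- `x` at both ends. Reading all vectors in one fixed space makes their velocities at time 0
-- meaningful.
open Filter Set Metric Topology in
theorem exists_flow_chart [CompleteSpace E] [T2Space M] [IsManifold 𝓘(ℝ, E) ∞ M]
    {X : ∀ x : M, TangentSpace 𝓘(ℝ, E) x}
    (hX : ContMDiff 𝓘(ℝ, E) 𝓘(ℝ, E).tangent ∞ (fun x => (⟨x, X x⟩ : TangentBundle 𝓘(ℝ, E) M)))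
    (x : M) :
    ∃ ε > (0 : ℝ), ∃ J : ℝ → E →L[ℝ] E,
      flow X 0 x = x ∧
      IsMIntegralCurveOn (fun t => flow X t x) X (Ioo (-ε) ε) ∧
      (∀ t ∈ Ioo (-ε) ε, flow X t x ∈ (extChartAt 𝓘(ℝ, E) x).source) ∧
      HasDerivAt (fun t => extChartAt 𝓘(ℝ, E) x (flow X t x)) (X x) 0 ∧
      (∀ t ∈ Ioo (-ε) ε, ∀ v : TangentSpace 𝓘(ℝ, E) x,
        mfderiv 𝓘(ℝ, E) 𝓘(ℝ, E) (extChartAt 𝓘(ℝ, E) x) (flow X t x)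
          (mfderiv 𝓘(ℝ, E) 𝓘(ℝ, E) (flow X t) x v) = J t v) ∧
      J 0 = ContinuousLinearMap.id ℝ E ∧
      HasDerivAt J (fderiv ℝ (chartField M x X) (extChartAt 𝓘(ℝ, E) x x)) 0 := by
  set φ := extChartAt 𝓘(ℝ, E) x with hφ
  have hX1 := hX.of_le (m := 1) (by simp)
  obtain ⟨r, hr, ε, hε, α, J, hα, hJ, hJ0, hJd⟩ :=
    exists_flow_hasFDerivAt (contDiffAt_chartField (x₀ := x) hX)
      (extChartAt_target_mem_nhds (I := 𝓘(ℝ, E)) x)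
  have h0 : (0 : ℝ) ∈ Ioo (-ε) ε := ⟨by linarith, hε⟩
  have hcurve : ∀ y ∈ ball (φ x) r,
      IsMIntegralCurveOn (fun t => φ.symm (α y t)) X (Ioo (-ε) ε) := fun y hy t ht =>
    (hasMFDerivAt_symm_chart_curve ((hα y hy).2 t ht).1 ((hα y hy).2 t ht).2).hasMFDerivWithinAt
  have hflow : ∀ y ∈ ball (φ x) r, ∀ t ∈ Ioo (-ε) ε, flow X t (φ.symm y) = φ.symm (α y t) := by
    intro y hy t ht
    have := flow_eq hX1 (hcurve y hy) h0 ht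
    rwa [(hα y hy).1] at this
  have hx : φ x ∈ ball (φ x) r := mem_ball_self hr
  have hxs : φ.symm (φ x) = x := extChartAt_to_inv (I := 𝓘(ℝ, E)) x
  have hflowx : ∀ t ∈ Ioo (-ε) ε, flow X t x = φ.symm (α (φ x) t) := by
    intro t ht
    have := hflow _ hx t ht
    rwa [hxs] at this
  have hsrc : ∀ t ∈ Ioo (-ε) ε, flow X t x ∈ φ.source := fun t ht => by
    rw [hflowx t ht]; exact φ.map_target ((hα _ hx).2 t ht).2
  have hφflow : ∀ t ∈ Ioo (-ε) ε, φ (flow X t x) = α (φ x) t := fun t ht => by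
    rw [hflowx t ht]; exact φ.right_inv ((hα _ hx).2 t ht).2
  refine ⟨ε, hε, J, ?_, ?_, hsrc, ?_, ?_, hJ0, hJd⟩
  · rw [hflowx 0 h0, (hα _ hx).1, hxs]
  · intro t ht
    -- The tangent spaces at equal points are equal only propositionally; both vectors are viewed in
    -- `E`.
    have hcongr : ∀ y z : M, y = z → (show ℝ →L[ℝ] E from (1 : ℝ →L[ℝ] ℝ).smulRight (X y)) =
        (show ℝ →L[ℝ] E from (1 : ℝ →L[ℝ] ℝ).smulRight (X z)) := by rintro _ _ rfl; rfl
    exact ((hcurve _ hx t ht).congr_of_eventuallyEq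
      (eventually_of_mem self_mem_nhdsWithin hflowx) (hflowx t ht)).congr_mfderiv
      (hcongr _ _ (hflowx t ht).symm)
  · have h := ((hα _ hx).2 0 h0).1
    rw [(hα _ hx).1, chartField_self] at h
    refine h.congr_of_eventuallyEq ?_
    filter_upwards [Ioo_mem_nhds h0.1 h0.2] with t ht using hφflow t ht
  · intro t ht v
    -- near `x`, the flow is `φ.symm ∘ α · t ∘ φ`
    have hloc : flow X t =ᶠ[𝓝 x] fun y => φ.symm (α (φ y) t) := by
      have h1 : ∀ᶠ y in 𝓝 x, φ y ∈ ball (φ x) r :=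
        (continuousAt_extChartAt (I := 𝓘(ℝ, E)) x).eventually (ball_mem_nhds _ hr)
      filter_upwards [h1, extChartAt_source_mem_nhds (I := 𝓘(ℝ, E)) x] with y hy hys
      have := hflow _ hy t ht
      rwa [φ.left_inv hys] at this
    have hd1 : HasMFDerivAt 𝓘(ℝ, E) 𝓘(ℝ, E) φ x (ContinuousLinearMap.id ℝ E) := by
      have := (mdifferentiableAt_extChartAt (I := 𝓘(ℝ, E)) (mem_chart_source E x)).hasMFDerivAt
      rwa [mfderiv_extChartAt_self] at this
    have hd2 : HasMFDerivAt 𝓘(ℝ, E) 𝓘(ℝ, E) (fun y => α (φ y) t) x (J t) := by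
      have := HasMFDerivAt.comp x ((hJ t ht).hasMFDerivAt) hd1
      exact this
    have ht2 := ((hα _ hx).2 t ht).2
    have hd3 : MDifferentiableAt 𝓘(ℝ, E) 𝓘(ℝ, E) φ.symm (α (φ x) t) :=
      (mdifferentiableWithinAt_extChartAt_symm (I := 𝓘(ℝ, E)) ht2).mdifferentiableAt (by simp)
    have hd4 : MDifferentiableAt 𝓘(ℝ, E) 𝓘(ℝ, E) (flow X t) x :=
      (hd3.comp x hd2.mdifferentiableAt).congr_of_eventuallyEq hloc
    have hd5 : MDifferentiableAt 𝓘(ℝ, E) 𝓘(ℝ, E) φ (flow X t x) :=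
      mdifferentiableAt_extChartAt (extChartAt_source 𝓘(ℝ, E) x ▸ hsrc t ht)
    have hd6 := (hd5.hasMFDerivAt.comp x hd4.hasMFDerivAt)
    have hev : φ ∘ flow X t =ᶠ[𝓝 x] fun y => α (φ y) t := by
      have h1 : ∀ᶠ y in 𝓝 x, φ y ∈ ball (φ x) r :=
        (continuousAt_extChartAt (I := 𝓘(ℝ, E)) x).eventually (ball_mem_nhds _ hr)
      filter_upwards [h1, hloc] with y hy hys
      rw [Function.comp_apply, hys]
      exact φ.right_inv ((hα _ hy).2 t ht).2
    have := hasMFDerivAt_unique hd6 (hd2.congr_of_eventuallyEq hev)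
    exact congrArg (fun L => L v) this

end FlowBasic

/-! ### Differentiating multilinear expressions; global extensions of local frames. -/

/-- The derivative of `b t (u t) - b t (w t)` for a curve `b` of multilinear maps and two curves
`u`, `w` of arguments which agree at time `0`. -/
theorem hasDerivAt_multilinear_sub {E V : Type*} [NormedAddCommGroup E] [NormedSpace ℝ E]
    [FiniteDimensional ℝ E] [NormedAddCommGroup V] [NormedSpace ℝ V] {k : ℕ}
    {b : ℝ → MultilinearMap ℝ (fun _ : Fin k => E) V}
    (hb : ∀ v, ∃ b', HasDerivAt (fun t => b t v) b' 0)
    {u w : ℝ → Fin k → E} {u' w' : Fin k → E}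
    (hu : ∀ i, HasDerivAt (fun t => u t i) (u' i) 0) (hw : ∀ i, HasDerivAt (fun t => w t i) (w' i) 0)
    (huw : u 0 = w 0) :
    HasDerivAt (fun t => b t (u t) - b t (w t))
      (∑ i, b 0 (Function.update (u 0) i (u' i - w' i))) 0 := by
  classical
  let bas := Module.finBasis ℝ E
  set ι := Fin (Module.finrank ℝ E)
  let m : (Fin k → ι) → ContinuousMultilinearMap ℝ (fun _ : Fin k => E) ℝ := fun a =>
    (ContinuousMultilinearMap.mkPiAlgebra ℝ (Fin k) ℝ).compContinuousLinearMap
      (fun i => LinearMap.toContinuousLinearMap (bas.coord (a i)))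
  have hm : ∀ a v, m a v = ∏ i, bas.coord (a i) (v i) := fun a v => by simp [m]
  -- Expansion in a basis reduces the time dependence of `b` to finitely many curves, so
  -- differentiability at each fixed argument suffices.
  have hexp : ∀ t v, b t v = ∑ a, m a v • b t (fun i => bas (a i)) := by
    intro t v
    conv_lhs => rw [show v = fun i => ∑ j, bas.repr (v i) j • bas j from
      funext fun i => (bas.sum_repr (v i)).symm]
    rw [MultilinearMap.map_sum]
    refine Finset.sum_congr rfl fun a _ => ?_
    rw [MultilinearMap.map_smul_univ, hm]
    rfl
  choose c hc using fun a : Fin k → ι => hb (fun i => bas (a i))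
  have key : ∀ (u : ℝ → Fin k → E) (u' : Fin k → E),
      (∀ i, HasDerivAt (fun t => u t i) (u' i) 0) →
      HasDerivAt (fun t => b t (u t)) (∑ a, m a (u 0) • c a +
        ∑ i, b 0 (Function.update (u 0) i (u' i))) 0 := by
    intro u u' hu
    have h1 : ∀ a, HasDerivAt (fun t => m a (u t) • b t (fun i => bas (a i)))
        (m a (u 0) • c a + (∑ i, m a (Function.update (u 0) i (u' i))) • b 0 (fun i => bas (a i)))
        0 := by
      intro a
      have h2 := ((m a).hasFDerivAt (u 0)).comp_hasDerivAt (0 : ℝ) (hasDerivAt_pi.2 hu)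
      rw [ContinuousMultilinearMap.linearDeriv_apply] at h2
      exact h2.smul (hc a)
    have h3 := HasDerivAt.fun_sum (u := Finset.univ) (fun a _ => h1 a)
    rw [show (fun t => b t (u t)) = fun t => ∑ a, m a (u t) • b t (fun i => bas (a i)) from
      funext fun t => hexp t (u t)]
    refine h3.congr_deriv ?_
    rw [Finset.sum_congr rfl fun i _ => hexp 0 (Function.update (u 0) i (u' i)), Finset.sum_add_distrib, Finset.sum_comm (s := Finset.univ (α := Fin k))]
    simp only [Finset.sum_smul]
  refine ((key u u' hu).sub (key w w' hw)).congr_deriv ?_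
  -- The terms with the derivative of `b` involve only the common value `u 0 = w 0`, hence cancel.
  rw [← huw, add_sub_add_left_eq_sub, ← Finset.sum_sub_distrib]
  exact Finset.sum_congr rfl fun i _ => ((b 0).map_update_sub _ _ _ _).symm

variable {E : Type*} [NormedAddCommGroup E] [NormedSpace ℝ E] [FiniteDimensional ℝ E]
  {M : Type*} [TopologicalSpace M] [T2Space M] [ChartedSpace E M] [IsManifold 𝓘(ℝ, E) ∞ M]

open Topology Filter in
/-- Near `x₀`, a tangent vector `w` is the value of a smooth vector field which depends linearly on
the expression of `w` in the chart at `x₀`. -/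
theorem exists_chart_frame (x₀ : M) : ∃ e : E →ₗ[ℝ] SmoothVF E M,
    ∀ᶠ y in 𝓝 x₀, ∀ w : TangentSpace 𝓘(ℝ, E) y,
      e (mfderiv 𝓘(ℝ, E) 𝓘(ℝ, E) (extChartAt 𝓘(ℝ, E) x₀) y w) y = w := by
  -- Smoothness of a form is tested on globally defined fields only, so the local constant frame is
  -- cut off by a bump function and extended by zero.
  obtain ⟨χ⟩ : Nonempty (SmoothBumpFunction 𝓘(ℝ, E) x₀) := inferInstance
  set T := trivializationAt E (TangentSpace 𝓘(ℝ, E) : M → Type _) x₀ with hT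
  have hbase : T.baseSet = (chartAt E x₀).source := TangentBundle.trivializationAt_baseSet x₀
  have hsm : ∀ v : E, ContMDiff 𝓘(ℝ, E) (𝓘(ℝ, E).prod 𝓘(ℝ, E)) ∞
      (fun y => (⟨y, ((χ : M → ℝ) • fun y => T.symmL ℝ y v) y⟩ :
        Bundle.TotalSpace E (TangentSpace 𝓘(ℝ, E) : M → Type _))) := by
    intro v
    refine ContMDiffOn.smul_section_of_tsupport (u := T.baseSet) χ.contMDiff.contMDiffOn
      T.open_baseSet ?_ ?_
    · rw [hbase]; exact χ.tsupport_subset_chartAt_source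
    · refine (T.contMDiffOn_section_baseSet_iff (IB := 𝓘(ℝ, E)) (n := ∞)).2 ?_
      refine contMDiffOn_const (c := v) |>.congr fun y hy => ?_
      simp only [T.symmL_apply (R := ℝ) hy, T.apply_mk_symm hy]
  let e : E →ₗ[ℝ] SmoothVF E M :=
    { toFun := fun v => ⟨(χ : M → ℝ) • fun y => T.symmL ℝ y v, hsm v⟩
      map_add' := fun v w => by
        ext y
        change χ y • T.symmL ℝ y (v + w) = χ y • T.symmL ℝ y v + χ y • T.symmL ℝ y w
        rw [map_add, smul_add]
      map_smul' := fun c v => by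
        ext y
        change χ y • T.symmL ℝ y (c • v) = c • χ y • T.symmL ℝ y v
        rw [map_smul, smul_comm] }
  refine ⟨e, ?_⟩
  filter_upwards [χ.eventuallyEq_one, chart_source_mem_nhds E x₀] with y hy hys w
  change χ y • T.symmL ℝ y _ = w
  rw [hy]
  have h1 := TangentBundle.continuousLinearMapAt_trivializationAt (I := 𝓘(ℝ, E)) (𝕜 := ℝ) hys
  have h2 := T.symmL_continuousLinearMapAt (R := ℝ) (hbase ▸ hys : y ∈ T.baseSet) w
  rw [h1] at h2
  exact (one_smul ℝ _).trans h2

open Topology Filter in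
/-- Every tangent vector extends to a smooth vector field. -/
theorem exists_smoothVF_eq (x : M) (w : TangentSpace 𝓘(ℝ, E) x) : ∃ Y : SmoothVF E M, Y x = w := by
  obtain ⟨e, he⟩ := exists_chart_frame (E := E) x
  exact ⟨_, he.self_of_nhds w⟩

/-! ### Equivariant functions of sections, the covariant derivative and horizontal flows. -/

section Bundle

variable
  {F : Type*} [NormedAddCommGroup F] [NormedSpace ℝ F]
  {G : Type*} [TopologicalSpace G] [ChartedSpace F G] [Group G] [LieGroup 𝓘(ℝ, F) ∞ G]
  {E : Type*} [NormedAddCommGroup E] [NormedSpace ℝ E]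
  {M : Type*} [TopologicalSpace M] [ChartedSpace E M] [IsManifold 𝓘(ℝ, E) ∞ M]
  {B : Type*} [NormedAddCommGroup B] [NormedSpace ℝ B]
  {P : Type*} [TopologicalSpace P] [ChartedSpace B P] [IsManifold 𝓘(ℝ, B) ∞ P]
  {V : Type*} [NormedAddCommGroup V] [NormedSpace ℝ V]
  {Q : PrincipalBundle F G E M B P} {ρ : Representation ℝ G V}

/-- The linear map `z ↦ p \ z`. -/
noncomputable def Assoc.coordLinear {x : M} (p : Q.Fiber x) : Assoc Q ρ x →ₗ[ℝ] V where
  toFun := Assoc.coord p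
  map_add' := Assoc.coord_add p
  map_smul' := Assoc.coord_smul p

theorem Assoc.coordLinear_apply {x : M} (p : Q.Fiber x) (z : Assoc Q ρ x) :
    Assoc.coordLinear p z = Assoc.coord p z := rfl

theorem sectionFun_eq_coord (s : ∀ x : M, Assoc Q ρ x) {x : M} (p : Q.Fiber x) :
    sectionFun s p.1 = Assoc.coord p (s x) := by
  obtain ⟨p, rfl⟩ := p
  rfl

theorem totalCoord_section (s : ∀ x : M, Assoc Q ρ x) {q : P} {x : M} (h : Q.proj q = x) :
    totalCoord (Q := Q) q ⟨x, s x⟩ = sectionFun s q := by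
  subst h
  rw [totalCoord, dif_pos rfl]
  rfl

theorem sectionFun_act (s : ∀ x : M, Assoc Q ρ x) (p : P) (g : G) :
    sectionFun s (Q.act p g) = ρ g⁻¹ (sectionFun s p) := by
  let p' : Q.Fiber (Q.proj p) := ⟨Q.act p g, Q.proj_act p g⟩
  rw [show Q.act p g = p'.1 from rfl, sectionFun_eq_coord s p', Assoc.coord_eq p' (Q.self p)]
  have : Q.div p' (Q.self p) = g⁻¹ := Q.div_eq _ _ (by
    change Q.act (Q.act p g) g⁻¹ = p
    rw [← Q.act_mul, mul_inv_cancel, Q.act_one])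
  rw [this]
  rfl

theorem sectionFun_sub (s t : ∀ x : M, Assoc Q ρ x) (p : P) :
    sectionFun (fun x => s x - t x) p = sectionFun s p - sectionFun t p :=
  map_sub (Assoc.coordLinear (Q.self p)) _ _

theorem sectionFun_sum {ι : Type*} (S : Finset ι) (s : ι → ∀ x : M, Assoc Q ρ x) (p : P) :
    sectionFun (fun x => ∑ i ∈ S, s i x) p = ∑ i ∈ S, sectionFun (s i) p :=
  map_sum (Assoc.coordLinear (Q.self p)) _ _

theorem IsSmoothSection.sub {s t : ∀ x : M, Assoc Q ρ x} (hs : IsSmoothSection s)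
    (ht : IsSmoothSection t) : IsSmoothSection (fun x => s x - t x) := by
  rw [IsSmoothSection, show sectionFun (fun x => s x - t x) = fun p =>
    sectionFun s p - sectionFun t p from funext (sectionFun_sub s t)]
  exact ContMDiff.sub hs ht

theorem IsSmoothSection.sum {ι : Type*} {S : Finset ι} {s : ι → ∀ x : M, Assoc Q ρ x}
    (hs : ∀ i ∈ S, IsSmoothSection (s i)) : IsSmoothSection (fun x => ∑ i ∈ S, s i x) := by
  rw [IsSmoothSection, show sectionFun (fun x => ∑ i ∈ S, s i x) = fun p =>
    ∑ i ∈ S, sectionFun (s i) p from funext (sectionFun_sum S s)]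
  exact contMDiff_finsetSum hs

namespace PrincipalConnection

variable (A : PrincipalConnection Q)

theorem base_horizontalLift (X : ∀ x : M, TangentSpace 𝓘(ℝ, E) x) :
    Q.base (A.horizontalLift X) = X := by
  have h : ∀ (x : M) (p : Q.Fiber x),
      (p.2 ▸ mfderiv 𝓘(ℝ, B) 𝓘(ℝ, E) Q.proj p.1 (A.horizontalLift X p.1) :
        TangentSpace 𝓘(ℝ, E) x) = X x := by
    rintro x ⟨p, rfl⟩
    exact A.proj_lift p _
  exact funext fun x => h x _

/-- Differentiate the equivariance relation `sectionFun_act` and use that the horizontal lift is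
invariant under the action. -/
theorem mfderiv_sectionFun_act [FiniteDimensional ℝ V] (X : ∀ x : M, TangentSpace 𝓘(ℝ, E) x)
    {s : ∀ x : M, Assoc Q ρ x} (hs : IsSmoothSection s) (p : P) (g : G) :
    (mfderiv 𝓘(ℝ, B) 𝓘(ℝ, V) (sectionFun s) (Q.act p g) (A.horizontalLift X (Q.act p g)) : V) =
      ρ g⁻¹ (mfderiv 𝓘(ℝ, B) 𝓘(ℝ, V) (sectionFun s) p (A.horizontalLift X p) : V) := by
  have hd : ∀ q, MDifferentiableAt 𝓘(ℝ, B) 𝓘(ℝ, V) (sectionFun s) q := fun q =>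
    (hs q).mdifferentiableAt (by simp)
  have hact : MDifferentiableAt 𝓘(ℝ, B) 𝓘(ℝ, B) (fun q => Q.act q g) p := by
    have : ContMDiff 𝓘(ℝ, B) 𝓘(ℝ, B) ∞ (fun q => Q.act q g) :=
      Q.smooth_act.comp (contMDiff_id.prodMk contMDiff_const)
    exact (this p).mdifferentiableAt (by simp)
  let R : V →L[ℝ] V := LinearMap.toContinuousLinearMap (ρ g⁻¹)
  have h1 : HasMFDerivAt 𝓘(ℝ, B) 𝓘(ℝ, V) (fun q => sectionFun s (Q.act q g)) p _ :=
    HasMFDerivAt.comp p (hd (Q.act p g)).hasMFDerivAt hact.hasMFDerivAt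
  have h2 : HasMFDerivAt 𝓘(ℝ, B) 𝓘(ℝ, V) (fun q => R (sectionFun s q)) p _ :=
    HasMFDerivAt.comp p (R.hasMFDerivAt) (hd p).hasMFDerivAt
  rw [show (fun q => sectionFun s (Q.act q g)) = fun q => R (sectionFun s q) from
    funext fun q => sectionFun_act s q g] at h1
  have h3 := congrArg (fun L => L (A.horizontalLift X p)) (hasMFDerivAt_unique h1 h2)
  have h4 : A.horizontalLift X (Q.act p g) =
    mfderiv 𝓘(ℝ, B) 𝓘(ℝ, B) (fun q => Q.act q g) p (A.horizontalLift X p) := A.equivariant X p g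
  rw [h4]
  exact h3

/-- Frees `nabla` from the chosen point of the fibre: the factor `ρ g⁻¹` of the previous lemma is
the change of coordinate between two points. -/
theorem coord_nabla [FiniteDimensional ℝ V] (X : ∀ x : M, TangentSpace 𝓘(ℝ, E) x)
    {s : ∀ x : M, Assoc Q ρ x} (hs : IsSmoothSection s) {x : M} (p : Q.Fiber x) :
    Assoc.coord p (A.nabla X s x) =
      mfderiv 𝓘(ℝ, B) 𝓘(ℝ, V) (sectionFun s) p.1 (A.horizontalLift X p.1) := by
  have h := A.mfderiv_sectionFun_act X hs (Q.point x).1 (Q.div (Q.point x) p)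
  have hinv : Q.div p (Q.point x) = (Q.div (Q.point x) p)⁻¹ := by
    rw [eq_inv_iff_mul_eq_one, Q.div_mul_div, Q.div_self]
  rw [Q.act_div] at h
  refine (Assoc.coord_mk p (Q.point x) _).trans ?_
  rw [hinv]
  exact h.symm

theorem sectionFun_nabla [FiniteDimensional ℝ V] (X : ∀ x : M, TangentSpace 𝓘(ℝ, E) x)
    {s : ∀ x : M, Assoc Q ρ x} (hs : IsSmoothSection s) (p : P) :
    sectionFun (A.nabla X s) p =
      mfderiv 𝓘(ℝ, B) 𝓘(ℝ, V) (sectionFun s) p (A.horizontalLift X p) :=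
  A.coord_nabla X hs (Q.self p)

/-- Its equivariant function is the fibre component of the tangent map of `sectionFun s` composed
with the smooth field X^H. -/
theorem isSmoothSection_nabla [FiniteDimensional ℝ V] (X : SmoothVF E M)
    {s : ∀ x : M, Assoc Q ρ x} (hs : IsSmoothSection s) : IsSmoothSection (A.nabla X s) := by
  have h1 : ContMDiff 𝓘(ℝ, B).tangent 𝓘(ℝ, V).tangent ∞
      (tangentMap 𝓘(ℝ, B) 𝓘(ℝ, V) (sectionFun s)) :=
    ContMDiff.contMDiff_tangentMap hs (by simp)
  have h2 := contMDiff_snd_tangentBundle_modelSpace V 𝓘(ℝ, V) (n := ∞) |>.comp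
    (h1.comp (A.smooth X))
  rw [IsSmoothSection, show sectionFun (A.nabla X s) = fun p =>
    (mfderiv 𝓘(ℝ, B) 𝓘(ℝ, V) (sectionFun s) p (A.horizontalLift X p) : V) from
    funext (A.sectionFun_nabla X hs)]
  exact h2

variable [FiniteDimensional ℝ B] [T2Space P] [T2Space M]

open Topology Filter Set in
/-- The flow of the horizontal lift covers the flow on the base, and computes derivatives along
the horizontal lift. -/
theorem eventually_proj_flow (Z : SmoothVF E M) (p : P) :
    (∀ᶠ t in 𝓝 (0 : ℝ), Q.proj (flow (A.horizontalLift Z) t p) = flow Z t (Q.proj p)) ∧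
    flow (A.horizontalLift Z) 0 p = p ∧
    ∀ f : P → V, ContMDiff 𝓘(ℝ, B) 𝓘(ℝ, V) ∞ f →
      HasDerivAt (fun t => f (flow (A.horizontalLift Z) t p))
        (mfderiv 𝓘(ℝ, B) 𝓘(ℝ, V) f p (A.horizontalLift Z p)) 0 := by
  obtain ⟨ε, hε, -, h0, hcurve, -⟩ := exists_flow_chart (A.smooth Z) p
  change flow (A.horizontalLift Z) 0 p = p at h0
  change IsMIntegralCurveOn (fun t => flow (A.horizontalLift Z) t p) (A.horizontalLift Z) _
    at hcurve
  have hmem : (0 : ℝ) ∈ Ioo (-ε) ε := ⟨by linarith, hε⟩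
  -- Since Tπ maps Z^H to Z, the projected curve is an integral curve of `Z`, and `flow_eq`
  -- identifies it with the flow.
  have hcurve' : IsMIntegralCurveOn (fun t => Q.proj (flow (A.horizontalLift Z) t p)) Z
      (Ioo (-ε) ε) := by
    intro t ht
    have hd := (Q.smooth_proj (flow (A.horizontalLift Z) t p)).mdifferentiableAt (by simp)
    refine (hd.hasMFDerivAt.comp_hasMFDerivWithinAt t (hcurve t ht)).congr_mfderiv ?_
    refine ContinuousLinearMap.ext fun c => ?_
    refine (map_smul (mfderiv 𝓘(ℝ, B) 𝓘(ℝ, E) Q.proj (flow (A.horizontalLift Z) t p))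
      (show ℝ from c) _).trans ?_
    exact congrArg (fun w : E => (show ℝ from c) • w) (A.proj_lift _ _)
  refine ⟨?_, h0, ?_⟩
  · filter_upwards [Ioo_mem_nhds hmem.1 hmem.2] with t ht
    have := flow_eq (Z.contMDiff.of_le (by simp)) hcurve' hmem ht
    rw [h0] at this
    exact this.symm
  · intro f hf
    have hd := (hf (flow (A.horizontalLift Z) 0 p)).mdifferentiableAt (by simp)
    have h1 := hd.hasMFDerivAt.comp (0 : ℝ)
      ((hcurve 0 hmem).hasMFDerivAt (Ioo_mem_nhds hmem.1 hmem.2))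
    have h3 : ∀ q, q = p → (mfderiv 𝓘(ℝ, B) 𝓘(ℝ, V) f q (A.horizontalLift Z q) : V) =
        mfderiv 𝓘(ℝ, B) 𝓘(ℝ, V) f p (A.horizontalLift Z p) := by rintro _ rfl; rfl
    have h2 : HasMFDerivAt 𝓘(ℝ, ℝ) 𝓘(ℝ, V) (fun t => f (flow (A.horizontalLift Z) t p)) 0
        ((1 : ℝ →L[ℝ] ℝ).smulRight
          (mfderiv 𝓘(ℝ, B) 𝓘(ℝ, V) f p (A.horizontalLift Z p) : V)) := by
      refine h1.congr_mfderiv (ContinuousLinearMap.ext fun c => ?_)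
      refine (map_smul (mfderiv 𝓘(ℝ, B) 𝓘(ℝ, V) f (flow (A.horizontalLift Z) 0 p))
        (show ℝ from c) _).trans ?_
      exact congrArg (fun w : V => (show ℝ from c) • w) (h3 _ h0)
    have h4 : HasFDerivAt (fun t => f (flow (A.horizontalLift Z) t p))
        ((1 : ℝ →L[ℝ] ℝ).smulRight
          (mfderiv 𝓘(ℝ, B) 𝓘(ℝ, V) f p (A.horizontalLift Z p) : V)) (0 : ℝ) :=
      hasMFDerivAt_iff_hasFDerivAt.1 h2
    exact h4.hasDerivAt.congr_deriv (one_smul ℝ _)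

end PrincipalConnection

end Bundle

/-! ### The Darboux–Lie derivative on decomposable k-vectors. -/

section Derivative

variable
  {F : Type*} [NormedAddCommGroup F] [NormedSpace ℝ F]
  {G : Type*} [TopologicalSpace G] [ChartedSpace F G] [Group G] [LieGroup 𝓘(ℝ, F) ∞ G]
  {E : Type*} [NormedAddCommGroup E] [NormedSpace ℝ E]
  {M : Type*} [TopologicalSpace M] [ChartedSpace E M] [IsManifold 𝓘(ℝ, E) ∞ M]
  {B : Type*} [NormedAddCommGroup B] [NormedSpace ℝ B]
  {P : Type*} [TopologicalSpace P] [ChartedSpace B P] [IsManifold 𝓘(ℝ, B) ∞ P]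
  {V : Type*} [NormedAddCommGroup V] [NormedSpace ℝ V]
  {Q : PrincipalBundle F G E M B P} {ρ : Representation ℝ G V} {k : ℕ}

/-- The value at `q` of the equivariant function of the section `β(e(v_1), …, e(v_k))`, as a
multilinear map in `v`, for a linear family `e` of vector fields. -/
noncomputable def AssocForm.frameMap (β : AssocForm Q ρ k) (e : E →ₗ[ℝ] SmoothVF E M) (q : P) :
    MultilinearMap ℝ (fun _ : Fin k => E) V :=
  ((Assoc.coordLinear (Q.self q)).compMultilinearMap
    (β.toFun (Q.proj q)).toMultilinearMap).compLinearMap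
    (fun _ =>
      { toFun := fun v => e v (Q.proj q)
        map_add' := fun v w => by rw [map_add]; rfl
        map_smul' := fun c v => by rw [map_smul]; rfl })

theorem AssocForm.frameMap_apply (β : AssocForm Q ρ k) (e : E →ₗ[ℝ] SmoothVF E M) (q : P)
    (v : Fin k → E) :
    β.frameMap e q v = sectionFun (fun y => β.toFun y (fun i => e (v i) y)) q := rfl

theorem AssocForm.bundleMap_map_ιMulti (β : AssocForm Q ρ k) {x y : M}
    (L : TangentSpace 𝓘(ℝ, E) x →ₗ[ℝ] TangentSpace 𝓘(ℝ, E) y)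
    (v : Fin k → TangentSpace 𝓘(ℝ, E) x) :
    β.bundleMap y (exteriorPower.map k L (exteriorPower.ιMulti ℝ k v)) =
      β.toFun y (fun i => L (v i)) := by
  rw [exteriorPower.map_apply_ιMulti, AssocForm.bundleMap,
    exteriorPower.alternatingMapLinearEquiv_apply_ιMulti]
  rfl

namespace PrincipalConnection

variable (A : PrincipalConnection Q)

/-- `∇_Z (β(Y_1, …, Y_k)) - ∑_i β(Y_1, …, [Z, Y_i], …, Y_k)`. -/
noncomputable def covLieFormula (Z : SmoothVF E M) (β : AssocForm Q ρ k) (Y : Fin k → SmoothVF E M)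
    (x : M) : Assoc Q ρ x :=
  A.nabla Z (fun y => β.toFun y (fun i => Y i y)) x -
    ∑ i, β.toFun x (Function.update (fun i => Y i x) i
      (VectorField.mlieBracket 𝓘(ℝ, E) Z (Y i) x))

variable [FiniteDimensional ℝ E] [FiniteDimensional ℝ B] [FiniteDimensional ℝ V]
  [T2Space P] [T2Space M]

-- The comparison of transported with restricted fields. The frame `e` turns both into arguments, in
-- the fixed space `E`, of one curve of multilinear maps.
open Topology Filter Set in
theorem hasDerivAt_darbouxLieCurve_ιMulti (Z : SmoothVF E M) (β : AssocForm Q ρ k)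
    (Y : Fin k → SmoothVF E M) (p : P) :
    HasDerivAt (darbouxLieCurve (A.horizontalLift Z) (fun y => β.bundleMap y) p
      ⟨Q.proj p, exteriorPower.ιMulti ℝ k (fun i => Y i (Q.proj p))⟩)
      (Assoc.coord (Q.self p) (A.covLieFormula Z β Y (Q.proj p))) 0 := by
  set x := Q.proj p with hx
  set φ := extChartAt 𝓘(ℝ, E) x with hφ
  obtain ⟨e, he⟩ := exists_chart_frame (E := E) x
  obtain ⟨ε, hε, J, h0, hcurve, hsrc, hφd, hJ, hJ0, hJd⟩ := exists_flow_chart Z.contMDiff x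
  obtain ⟨hproj, hp0, hsec⟩ := A.eventually_proj_flow (V := V) Z p
  set q : ℝ → P := fun t => flow (A.horizontalLift Z) t p with hq
  have hq0 : q 0 = p := hp0
  have hmem : (0 : ℝ) ∈ Ioo (-ε) ε := ⟨by linarith, hε⟩
  have hcont : ContinuousAt (fun t => flow Z t x) 0 :=
    (hcurve 0 hmem).continuousWithinAt.continuousAt (Ioo_mem_nhds hmem.1 hmem.2)
  have he' : ∀ᶠ t in 𝓝 (0 : ℝ), ∀ w : TangentSpace 𝓘(ℝ, E) (flow Z t x),
      e (mfderiv 𝓘(ℝ, E) 𝓘(ℝ, E) φ (flow Z t x) w) (flow Z t x) = w := by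
    have hlim : Tendsto (fun t => flow Z t x) (𝓝 0) (𝓝 x) := by
      have := hcont.tendsto
      rwa [show flow Z 0 x = x from h0] at this
    exact hlim.eventually he
  have hex : ∀ w : TangentSpace 𝓘(ℝ, E) x, e w x = w := by
    intro w
    have := he.self_of_nhds w
    rw [mfderiv_extChartAt_self] at this
    exact this
  -- the expressions in the chart of the transported and of the restricted vector fields
  let u : ℝ → Fin k → E := fun t i => J t (Y i x)
  let w : ℝ → Fin k → E := fun t i => chartField M x (Y i) (φ (flow Z t x))
  have hu : ∀ i, HasDerivAt (fun t => u t i) (fderiv ℝ (chartField M x Z) (φ x) (Y i x)) 0 := by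
    intro i
    exact (hJd.clm_apply (hasDerivAt_const (0 : ℝ) (show E from Y i x))).congr_deriv
      (by rw [map_zero, add_zero])
  have hw : ∀ i, HasDerivAt (fun t => w t i)
      (fderiv ℝ (chartField M x (Y i)) (φ x) (Z x)) 0 := by
    intro i
    have h1 : HasFDerivAt (chartField M x (Y i)) (fderiv ℝ (chartField M x (Y i)) (φ x))
        (φ (flow Z 0 x)) := by
      rw [show flow Z 0 x = x from h0]
      exact ((contDiffAt_chartField (Y i).contMDiff).differentiableAt (by simp)).hasFDerivAt
    exact h1.comp_hasDerivAt (0 : ℝ) hφd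
  have hu0 : u 0 = fun i => Y i x := by
    funext i
    change J 0 (Y i x) = Y i x
    rw [hJ0]
    rfl
  have hw0 : w 0 = fun i => Y i x := by
    funext i
    change chartField M x (Y i) (φ (flow Z 0 x)) = Y i x
    rw [show flow Z 0 x = x from h0, hφ, chartField_self]
  have hb : ∀ v, ∃ b', HasDerivAt (fun t => β.frameMap e (q t) v) b' 0 := fun v =>
    ⟨_, hsec _ (β.smooth (fun i => e (v i)))⟩
  -- The curve is written as (value at `u` − value at `w`) + value at `w`; the last is the
  -- equivariant function of β(Y) along `q`, which gives ∇_Z.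
  have hmain := (hasDerivAt_multilinear_sub hb hu hw (hu0.trans hw0.symm)).add
    (hsec _ (β.smooth Y))
  refine (hmain.congr_of_eventuallyEq ?_).congr_deriv ?_
  · filter_upwards [he', hproj, Ioo_mem_nhds hmem.1 hmem.2] with t het hpt ht
    have h1 : β.frameMap e (q t) (w t) = sectionFun (fun y => β.toFun y (fun i => Y i y)) (q t) := by
      change Assoc.coord _ (β.toFun (Q.proj (q t)) (fun i => e (w t i) (Q.proj (q t)))) =
        Assoc.coord _ (β.toFun (Q.proj (q t)) (fun i => Y i (Q.proj (q t))))
      congr 2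
      funext i
      change e (chartField M x (Y i) (φ (flow Z t x))) (Q.proj (q t)) = _
      have h2 := hsrc t ht
      rw [← hpt] at het h2 ⊢
      rw [hφ, chartField_extChartAt h2]
      exact het _
    have h3 : darbouxLieCurve (A.horizontalLift Z) (fun y => β.bundleMap y) p
        ⟨x, exteriorPower.ιMulti ℝ k (fun i => Y i x)⟩ t = β.frameMap e (q t) (u t) := by
      rw [darbouxLieCurve, A.base_horizontalLift, AssocForm.frameMap_apply,
        ← totalCoord_section _ hpt]
      change totalCoord (q t) ⟨flow Z t x, β.bundleMap _ (exteriorPower.map k _ _)⟩ = _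
      rw [AssocForm.bundleMap_map_ιMulti]
      congr 3
      funext i
      exact (het _).symm.trans (congrArg (fun v => e v (flow Z t x)) (hJ t ht (Y i x)))
    change _ = β.frameMap e (q t) (u t) - β.frameMap e (q t) (w t) +
      sectionFun (fun y => β.toFun y (fun i => Y i y)) (q t)
    rw [h3, h1, sub_add_cancel]
  -- Here DZ(Y_i) − DY_i(Z) = −[Z, Y_i], the source of the minus sign in the formula.
  · have h4 : ∀ i, β.frameMap e (q 0) (Function.update (u 0) i
        (fderiv ℝ (chartField M x Z) (φ x) (Y i x) -
          fderiv ℝ (chartField M x (Y i)) (φ x) (Z x))) =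
        - Assoc.coordLinear (Q.self p) (β.toFun x (Function.update (fun i => Y i x) i
          (VectorField.mlieBracket 𝓘(ℝ, E) Z (Y i) x))) := by
      intro i
      rw [hq0, AssocForm.frameMap_apply, ← map_neg, ← AlternatingMap.map_update_neg,
        mlieBracket_eq_chartField, hu0]
      change Assoc.coord _ (β.toFun x _) = Assoc.coord _ (β.toFun x _)
      congr 2
      funext j
      exact (hex _).trans (congrArg
        (fun b : E => Function.update (fun i => (show E from Y i x)) i b j) (neg_sub _ _).symm)
    change (∑ i, β.frameMap e (q 0) _) + _ = _
    rw [Finset.sum_congr rfl fun i _ => h4 i, covLieFormula, ← Assoc.coordLinear_apply, map_sub,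
      map_sum, Finset.sum_neg_distrib]
    exact (congrArg (fun d : V => -_ + d) (A.coord_nabla Z (β.smooth Y) (Q.self p)).symm).trans
      (neg_add_eq_sub _ _)

end PrincipalConnection

end Derivative

/-! ### Cartan's formula for the covariant-Lie derivative. -/

section Algebra

theorem succ_removeNth_vecCons {α : Type*} {m : ℕ} (j : Fin (m + 1)) (a : α)
    (v : Fin (m + 1) → α) :
    j.succ.removeNth (Matrix.vecCons a v) = Matrix.vecCons a (j.removeNth v) := by
  funext i
  refine Fin.cases ?_ (fun i => ?_) i <;> simp [Fin.removeNth]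

theorem sum_Ici_zero {N : Type*} [AddCommMonoid N] {m : ℕ} (f : Fin (m + 1) → N) :
    ∑ j ∈ Finset.Ici 0, f j = ∑ j, f j := by
  refine Finset.sum_congr ?_ fun _ _ => rfl
  ext j; simp

theorem sum_Ici_succ {N : Type*} [AddCommMonoid N] {m : ℕ} (i : Fin m) (f : Fin (m + 1) → N) :
    ∑ j ∈ Finset.Ici i.succ, f j = ∑ j ∈ Finset.Ici i, f j.succ := by
  have h : ∀ (n : ℕ) (a : Fin n), Finset.Ici a = Finset.univ.filter (a ≤ ·) := fun n a => by
    ext; simp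
  rw [h, h, Finset.sum_filter, Finset.sum_filter, Fin.sum_univ_succ]
  simp [Fin.succ_le_succ_iff]

theorem vecCons_eval {ι : Type*} {T : ι → Type*} {m : ℕ} (Z : ∀ x, T x) (Y : Fin m → ∀ x, T x)
    (x : ι) : (fun i => Matrix.vecCons Z Y i x) = Matrix.vecCons (Z x) (fun i => Y i x) := by
  funext i
  refine Fin.cases rfl (fun _ => rfl) i

theorem vecCons_removeNth_eq_update {T N : Type*} [AddCommGroup T] [Module ℝ T] [AddCommGroup N]
    [Module ℝ N] {m : ℕ} (f : T [⋀^Fin (m + 1)]→ₗ[ℝ] N) (j : Fin (m + 1)) (a : T)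
    (v : Fin (m + 1) → T) :
    (-1 : ℝ) ^ (j : ℕ) • f (Matrix.vecCons a (j.removeNth v)) = f (Function.update v j a) := by
  rw [← Fin.insertNth_removeNth, AlternatingMap.map_insertNth, ← Int.cast_smul_eq_zsmul ℝ]
  simp

theorem map_vecCons_swap {T N : Type*} [AddCommGroup T] [Module ℝ T] [AddCommGroup N]
    [Module ℝ N] {m : ℕ} (f : T [⋀^Fin (m + 2)]→ₗ[ℝ] N) (a b : T) (v : Fin m → T) :
    f (Matrix.vecCons a (Matrix.vecCons b v)) = -f (Matrix.vecCons b (Matrix.vecCons a v)) := by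
  rw [← f.map_swap _ (show (0 : Fin (m + 2)) ≠ 1 by simp)]
  congr 1
  funext i
  refine Fin.cases ?_ (fun i => Fin.cases ?_ (fun i => ?_) i) i
  · simp
  · simp
  · rw [Function.comp_apply, Equiv.swap_apply_of_ne_of_ne] <;> simp [Fin.ext_iff]

variable
  {F : Type*} [NormedAddCommGroup F] [NormedSpace ℝ F]
  {G : Type*} [TopologicalSpace G] [ChartedSpace F G] [Group G] [LieGroup 𝓘(ℝ, F) ∞ G]
  {E : Type*} [NormedAddCommGroup E] [NormedSpace ℝ E]
  {M : Type*} [TopologicalSpace M] [ChartedSpace E M] [IsManifold 𝓘(ℝ, E) ∞ M]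
  {B : Type*} [NormedAddCommGroup B] [NormedSpace ℝ B]
  {P : Type*} [TopologicalSpace P] [ChartedSpace B P] [IsManifold 𝓘(ℝ, B) ∞ P]
  {V : Type*} [NormedAddCommGroup V] [NormedSpace ℝ V]
  {Q : PrincipalBundle F G E M B P} {ρ : Representation ℝ G V}

theorem AssocForm.interior_apply {m : ℕ} (Z : SmoothVF E M) (β : AssocForm Q ρ (m + 1)) (x : M)
    (v : Fin m → TangentSpace 𝓘(ℝ, E) x) :
    (β.interior Z).toFun x v = β.toFun x (Matrix.vecCons (Z x) v) := rfl

namespace PrincipalConnection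

variable (A : PrincipalConnection Q)

/-- Omitting index 0 leaves ∇_Z; omitting j + 1 keeps Z in the first slot, and the shifted index
costs a sign. -/
theorem dNablaFirst_vecCons {m : ℕ} (Z : SmoothVF E M) (β : AssocForm Q ρ (m + 1))
    (Y : Fin (m + 1) → ∀ x : M, TangentSpace 𝓘(ℝ, E) x) (x : M) :
    A.dNablaFirst β (Matrix.vecCons Z Y) x =
      A.nabla Z (fun y => β.toFun y (fun i => Y i y)) x - A.dNablaFirst (β.interior Z) Y x := by
  rw [dNablaFirst, Fin.sum_univ_succ, dNablaFirst, sub_eq_add_neg, ← Finset.sum_neg_distrib]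
  congr 1
  · rw [Fin.val_zero, pow_zero, one_smul]
    rfl
  · refine Finset.sum_congr rfl fun j _ => ?_
    rw [Fin.val_succ, pow_succ, mul_neg_one, neg_smul]
    congr 3
    funext y
    rw [succ_removeNth_vecCons, vecCons_eval, AssocForm.interior_apply]

/-- The part of the exterior covariant derivative which involves the Lie brackets. -/
noncomputable def bracketSum {m : ℕ} (β : AssocForm Q ρ (m + 1))
    (X : Fin (m + 2) → ∀ x : M, TangentSpace 𝓘(ℝ, E) x) (x : M) : Assoc Q ρ x :=
  ∑ i : Fin (m + 1), ∑ j ∈ Finset.Ici i, (-1 : ℝ) ^ ((i : ℕ) + (j : ℕ)) •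
    β.toFun x (Matrix.vecCons
      (VectorField.mlieBracket 𝓘(ℝ, E) (X (Fin.castSucc i)) (X (Fin.succ j)) x)
      (fun l => j.removeNth ((Fin.castSucc i).removeNth X) l x))

/-- The row of index 0 holds the brackets with Z, whose sign moves the bracket from the front into
slot j. In the other rows both indices shift by one, so the sign is unchanged. -/
theorem bracketSum_vecCons {m : ℕ} (Z : SmoothVF E M) (β : AssocForm Q ρ (m + 1))
    (Y : Fin (m + 1) → ∀ x : M, TangentSpace 𝓘(ℝ, E) x) (x : M) :
    bracketSum β (Matrix.vecCons Z Y) x =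
      ∑ j, β.toFun x (Function.update (fun i => Y i x) j
        (VectorField.mlieBracket 𝓘(ℝ, E) Z (Y j) x)) +
      ∑ i : Fin m, ∑ j ∈ Finset.Ici i, (-1 : ℝ) ^ ((i : ℕ) + (j : ℕ)) •
        β.toFun x (Matrix.vecCons
          (VectorField.mlieBracket 𝓘(ℝ, E) (Y (Fin.castSucc i)) (Y (Fin.succ j)) x)
          (fun l => j.succ.removeNth (i.castSucc.succ.removeNth (Matrix.vecCons (Z : ∀ x : M,
            TangentSpace 𝓘(ℝ, E) x) Y)) l x)) := by
  rw [bracketSum, Fin.sum_univ_succ]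
  congr 1
  · rw [sum_Ici_zero]
    refine Finset.sum_congr rfl fun j _ => ?_
    rw [Fin.val_zero, zero_add, ← vecCons_removeNth_eq_update]
    rfl
  · refine Finset.sum_congr rfl fun i _ => ?_
    rw [sum_Ici_succ]
    refine Finset.sum_congr rfl fun j _ => ?_
    congr 1
    rw [Fin.val_succ, Fin.val_succ, show (i : ℕ) + 1 + (j + 1) = i + j + 2 by ring, pow_add]
    simp

theorem dNabla_zero (β : AssocForm Q ρ 0) (X : Fin 1 → ∀ x : M, TangentSpace 𝓘(ℝ, E) x) (x : M) :
    A.dNabla β X x = A.dNablaFirst β X x := rfl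

theorem dNabla_succ {m : ℕ} (β : AssocForm Q ρ (m + 1))
    (X : Fin (m + 2) → ∀ x : M, TangentSpace 𝓘(ℝ, E) x) (x : M) :
    A.dNabla β X x = A.dNablaFirst β X x - bracketSum β X x := rfl

theorem covLie_succ {m : ℕ} (Z : SmoothVF E M) (β : AssocForm Q ρ (m + 1))
    (Y : Fin (m + 1) → ∀ x : M, TangentSpace 𝓘(ℝ, E) x) (x : M) :
    A.covLie Z β Y x = A.dNabla β (Matrix.vecCons Z Y) x + A.dNabla (β.interior Z) Y x := rfl

/-- The terms ∇_{Y_j} cancel by the sign in `dNablaFirst_vecCons`. The brackets [Y_a, Y_b] cancel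
because i_Z puts Z before the bracket, whereas d^∇ β puts the bracket before Z. -/
theorem covLie_eq_covLieFormula {k : ℕ} (Z : SmoothVF E M) (β : AssocForm Q ρ k)
    (Y : Fin k → SmoothVF E M) (x : M) :
    A.covLie Z β (fun i => Y i) x = A.covLieFormula Z β Y x := by
  rcases k with _ | m
  · rw [covLieFormula, Finset.univ_eq_empty, Finset.sum_empty, sub_zero]
    change A.dNablaFirst β _ x = _
    rw [dNablaFirst, Fin.sum_univ_one, Fin.val_zero, pow_zero, one_smul]
    change A.nabla Z _ x = _
    congr 1
  · rw [covLie_succ, dNabla_succ, dNablaFirst_vecCons, bracketSum_vecCons, covLieFormula]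
    -- For a 1-form, i_Z β has degree 0 and no bracket sum, so this degree is separate.
    rcases m with _ | m
    · rw [dNabla_zero, Finset.univ_eq_empty (α := Fin 0), Finset.sum_empty]
      abel
    · rw [dNabla_succ]
      have h : bracketSum (β.interior Z) (fun i => Y i) x =
          -∑ i : Fin (m + 1), ∑ j ∈ Finset.Ici i, (-1 : ℝ) ^ ((i : ℕ) + (j : ℕ)) •
          β.toFun x (Matrix.vecCons
            (VectorField.mlieBracket 𝓘(ℝ, E) (Y (Fin.castSucc i)) (Y (Fin.succ j)) x)
            (fun l => j.succ.removeNth (i.castSucc.succ.removeNth (Matrix.vecCons (Z : ∀ x : M,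
              TangentSpace 𝓘(ℝ, E) x) fun i => Y i)) l x)) := by
        rw [bracketSum, ← Finset.sum_neg_distrib]
        refine Finset.sum_congr rfl fun i _ => ?_
        rw [← Finset.sum_neg_distrib]
        refine Finset.sum_congr rfl fun j _ => ?_
        rw [← smul_neg, succ_removeNth_vecCons, succ_removeNth_vecCons, vecCons_eval,
          AssocForm.interior_apply, map_vecCons_swap]
      rw [h]
      abel

/-- ∇_Z preserves smooth sections, and [Z, Y_i] is a smooth field, hence an admissible argument of
β. -/
theorem isSmoothSection_covLieFormula [FiniteDimensional ℝ E] [FiniteDimensional ℝ V] {k : ℕ}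
    (Z : SmoothVF E M) (β : AssocForm Q ρ k) (Y : Fin k → SmoothVF E M) :
    IsSmoothSection (A.covLieFormula Z β Y) := by
  refine (A.isSmoothSection_nabla Z (β.smooth Y)).sub (IsSmoothSection.sum fun i _ => ?_)
  have h2 : (2 : WithTop ℕ∞) ≤ ∞ := by norm_cast
  -- The bracket loses one derivative, so order ∞ + 1 is asked for, which is ∞ again.
  have : IsManifold 𝓘(ℝ, E) (((⊤ : ℕ∞) : WithTop ℕ∞) + 1) M :=
    inferInstanceAs (IsManifold 𝓘(ℝ, E) ∞ M)
  have : IsManifold 𝓘(ℝ, E) (minSmoothness ℝ 2) M := by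
    rw [minSmoothness_of_isRCLikeNormedField]; exact IsManifold.of_le h2
  let W : SmoothVF E M := ⟨VectorField.mlieBracket 𝓘(ℝ, E) Z (Y i), fun x =>
    ContMDiffAt.mlieBracket_vectorField (m := ⊤) (n := ⊤) (Z.contMDiff x) ((Y i).contMDiff x)
      (by simp [minSmoothness_of_isRCLikeNormedField])⟩
  have h := β.smooth (Function.update Y i W)
  convert! h using 3 with x
  funext j
  by_cases hj : j = i
  · subst hj; simp; rfl
  · simp [hj]

end PrincipalConnection

end Algebra

/-! ### Extension to all k-vectors and the resulting form. -/

section DarbouxLieForm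

variable
  {F : Type*} [NormedAddCommGroup F] [NormedSpace ℝ F]
  {G : Type*} [TopologicalSpace G] [ChartedSpace F G] [Group G] [LieGroup 𝓘(ℝ, F) ∞ G]
  {E : Type*} [NormedAddCommGroup E] [NormedSpace ℝ E] [FiniteDimensional ℝ E]
  {M : Type*} [TopologicalSpace M] [T2Space M] [ChartedSpace E M] [IsManifold 𝓘(ℝ, E) ∞ M]
  {B : Type*} [NormedAddCommGroup B] [NormedSpace ℝ B] [FiniteDimensional ℝ B]
  {P : Type*} [TopologicalSpace P] [T2Space P] [ChartedSpace B P] [IsManifold 𝓘(ℝ, B) ∞ P]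
  {V : Type*} [NormedAddCommGroup V] [NormedSpace ℝ V] [FiniteDimensional ℝ V]
  {Q : PrincipalBundle F G E M B P} {ρ : Representation ℝ G V} {k : ℕ}

/-- `darbouxLieCurve` at `w` is a fixed family of linear maps evaluated at `w`. -/
theorem exists_linear_darbouxLieCurve (X : ∀ p : P, TangentSpace 𝓘(ℝ, B) p) (β : AssocForm Q ρ k)
    (p : P) (x : M) : ∃ c : ℝ → ⋀[ℝ]^k (TangentSpace 𝓘(ℝ, E) x) →ₗ[ℝ] V,
      ∀ w, darbouxLieCurve X (fun y => β.bundleMap y) p ⟨x, w⟩ = fun t => c t w := by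
  have h : ∀ t, ∃ c : ⋀[ℝ]^k (TangentSpace 𝓘(ℝ, E) x) →ₗ[ℝ] V,
      ∀ w, darbouxLieCurve X (fun y => β.bundleMap y) p ⟨x, w⟩ t = c w := by
    intro t
    -- If the two flows do not lie over the same point, `totalCoord` takes its default value 0,
    -- which is still linear in `w`.
    by_cases h : Q.proj (flow X t p) = flow (Q.base X) t x
    · refine ⟨(Assoc.coordLinear ⟨flow X t p, h⟩).comp ((β.bundleMap _).comp
        (exteriorPower.map k (mfderiv 𝓘(ℝ, E) 𝓘(ℝ, E) (flow (Q.base X) t) x).toLinearMap)),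
        fun w => ?_⟩
      exact dif_pos h
    · exact ⟨0, fun w => dif_neg h⟩
  choose c hc using h
  exact ⟨c, fun w => funext fun t => hc t w⟩

namespace PrincipalConnection

variable (A : PrincipalConnection Q)

theorem hasDerivAt_darbouxLieCurve_ιMulti' (Z : SmoothVF E M) (β : AssocForm Q ρ k)
    (Y : Fin k → SmoothVF E M) {x : M} (p : Q.Fiber x) :
    HasDerivAt (darbouxLieCurve (A.horizontalLift Z) (fun y => β.bundleMap y) p.1
      ⟨x, exteriorPower.ιMulti ℝ k (fun i => Y i x)⟩)
      (Assoc.coord p (A.covLieFormula Z β Y x)) 0 := by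
  obtain ⟨p, rfl⟩ := p
  exact A.hasDerivAt_darbouxLieCurve_ιMulti Z β Y p

/-- The vector `z` is chosen before `p`, so independence of the point in the fibre is carried
through the induction over the span of decomposable k-vectors. -/
theorem exists_hasDerivAt_darbouxLieCurve (Z : SmoothVF E M) (β : AssocForm Q ρ k) (x : M)
    (w : ⋀[ℝ]^k (TangentSpace 𝓘(ℝ, E) x)) : ∃ z : Assoc Q ρ x, ∀ p : Q.Fiber x,
      HasDerivAt (darbouxLieCurve (A.horizontalLift Z) (fun y => β.bundleMap y) p.1 ⟨x, w⟩)
        (Assoc.coord p z) 0 := by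
  have hw : w ∈ Submodule.span ℝ (Set.range (exteriorPower.ιMulti ℝ k
      (M := TangentSpace 𝓘(ℝ, E) x))) := by
    rw [exteriorPower.ιMulti_span]; trivial
  have hlin := fun p : Q.Fiber x =>
    exists_linear_darbouxLieCurve (A.horizontalLift Z) β p.1 x
  choose c hc using hlin
  simp only [hc]
  induction hw using Submodule.span_induction with
  | mem w h =>
    obtain ⟨v, rfl⟩ := h
    -- Extending the vectors to fields makes the formula with ∇ and brackets available; the
    -- derivative itself depends only on their values at `x`.
    choose Y hY using fun i => exists_smoothVF_eq x (v i)
    obtain rfl : (fun i => Y i x) = v := funext hY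
    refine ⟨A.covLieFormula Z β Y x, fun p => ?_⟩
    rw [← hc]
    exact A.hasDerivAt_darbouxLieCurve_ιMulti' Z β Y p
  | zero => exact ⟨0, fun p => by
      simpa only [map_zero, ← Assoc.coordLinear_apply] using hasDerivAt_const (0 : ℝ) (0 : V)⟩
  | add w₁ w₂ _ _ h₁ h₂ =>
    obtain ⟨z₁, h₁⟩ := h₁
    obtain ⟨z₂, h₂⟩ := h₂
    refine ⟨z₁ + z₂, fun p => ?_⟩
    simp only [map_add, Assoc.coord_add]
    exact (h₁ p).add (h₂ p)
  | smul r w _ h =>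
    obtain ⟨z, h⟩ := h
    refine ⟨r • z, fun p => ?_⟩
    simp only [map_smul, Assoc.coord_smul]
    exact (h p).const_smul r

theorem darbouxLie_eq {Z : SmoothVF E M} {β : AssocForm Q ρ k} {x : M}
    {w : ⋀[ℝ]^k (TangentSpace 𝓘(ℝ, E) x)} {z : Assoc Q ρ x}
    (h : HasDerivAt (darbouxLieCurve (A.horizontalLift Z) (fun y => β.bundleMap y) (Q.point x).1
      ⟨x, w⟩) (Assoc.coord (Q.point x) z) 0) :
    darbouxLie (A.horizontalLift Z) (fun y => β.bundleMap y) x w = z := by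
  rw [darbouxLie, h.deriv, Assoc.mk_coord]

theorem hasDerivAt_darbouxLieCurve (Z : SmoothVF E M) (β : AssocForm Q ρ k) {x : M}
    (p : Q.Fiber x) (w : ⋀[ℝ]^k (TangentSpace 𝓘(ℝ, E) x)) :
    HasDerivAt (darbouxLieCurve (A.horizontalLift Z) (fun y => β.bundleMap y) p.1 ⟨x, w⟩)
      (Assoc.coord p (darbouxLie (A.horizontalLift Z) (fun y => β.bundleMap y) x w)) 0 := by
  obtain ⟨z, hz⟩ := A.exists_hasDerivAt_darbouxLieCurve Z β x w
  rw [A.darbouxLie_eq (hz _)]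
  exact hz p

/-- The Darboux–Lie derivative along a horizontal lift, as a linear map on `Λ^k T_x M`. -/
noncomputable def darbouxLieLinear (Z : SmoothVF E M) (β : AssocForm Q ρ k) (x : M) :
    ⋀[ℝ]^k (TangentSpace 𝓘(ℝ, E) x) →ₗ[ℝ] Assoc Q ρ x where
  toFun := darbouxLie (A.horizontalLift Z) (fun y => β.bundleMap y) x
  map_add' w₁ w₂ := by
    refine A.darbouxLie_eq ?_
    obtain ⟨c, hc⟩ := exists_linear_darbouxLieCurve (A.horizontalLift Z) β (Q.point x).1 x
    have h₁ := A.hasDerivAt_darbouxLieCurve Z β (Q.point x) w₁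
    have h₂ := A.hasDerivAt_darbouxLieCurve Z β (Q.point x) w₂
    rw [hc] at h₁ h₂ ⊢
    simp only [map_add, Assoc.coord_add]
    exact h₁.add h₂
  map_smul' r w := by
    refine A.darbouxLie_eq ?_
    obtain ⟨c, hc⟩ := exists_linear_darbouxLieCurve (A.horizontalLift Z) β (Q.point x).1 x
    have h := A.hasDerivAt_darbouxLieCurve Z β (Q.point x) w
    rw [hc] at h ⊢
    simp only [map_smul, Assoc.coord_smul, RingHom.id_apply]
    exact h.const_smul r

theorem darbouxLieLinear_ιMulti (Z : SmoothVF E M) (β : AssocForm Q ρ k)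
    (Y : Fin k → SmoothVF E M) (x : M) :
    A.darbouxLieLinear Z β x (exteriorPower.ιMulti ℝ k (fun i => Y i x)) =
      A.covLieFormula Z β Y x :=
  A.darbouxLie_eq (A.hasDerivAt_darbouxLieCurve_ιMulti' Z β Y (Q.point x))

/-- The Darboux–Lie derivative of a `k`-form along a horizontal lift is a `k`-form. -/
noncomputable def darbouxLieForm (Z : SmoothVF E M) (β : AssocForm Q ρ k) : AssocForm Q ρ k where
  toFun x := exteriorPower.alternatingMapLinearEquiv.symm (A.darbouxLieLinear Z β x)
  smooth Y := by
    convert! A.isSmoothSection_covLieFormula Z β Y using 2 with x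
    rw [exteriorPower.alternatingMapLinearEquiv_symm_apply]
    exact A.darbouxLieLinear_ιMulti Z β Y x

end PrincipalConnection

end DarbouxLieForm

end DarbouxLie

open DarbouxLie in
theorem mainTheorem12
    {F : Type*} [NormedAddCommGroup F] [NormedSpace ℝ F] [FiniteDimensional ℝ F]
    {G : Type*} [TopologicalSpace G] [ChartedSpace F G] [Group G] [LieGroup 𝓘(ℝ, F) ∞ G]
    {E : Type*} [NormedAddCommGroup E] [NormedSpace ℝ E] [FiniteDimensional ℝ E]
    {M : Type*} [TopologicalSpace M] [T2Space M] [ChartedSpace E M] [IsManifold 𝓘(ℝ, E) ∞ M]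
    {B : Type*} [NormedAddCommGroup B] [NormedSpace ℝ B] [FiniteDimensional ℝ B]
    {P : Type*} [TopologicalSpace P] [T2Space P] [ChartedSpace B P] [IsManifold 𝓘(ℝ, B) ∞ P]
    {V : Type*} [NormedAddCommGroup V] [NormedSpace ℝ V] [FiniteDimensional ℝ V]
    (Q : PrincipalBundle F G E M B P) (A : PrincipalConnection Q)
    (ρ : Representation ℝ G V)
    (hρ : ContMDiff (𝓘(ℝ, F).prod 𝓘(ℝ, V)) 𝓘(ℝ, V) ∞ (fun a : G × V => ρ a.1 a.2))
    (Z : SmoothVF E M) (k : ℕ) (β : AssocForm Q ρ k) :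
    -- `Z^H` is a smooth `G`-invariant vector field that projects onto `Z`
    (ContMDiff 𝓘(ℝ, B) 𝓘(ℝ, B).tangent ∞
        (fun p => (⟨p, A.horizontalLift Z p⟩ : TangentBundle 𝓘(ℝ, B) P)) ∧
      (∀ p g, A.horizontalLift Z (Q.act p g) =
        mfderiv 𝓘(ℝ, B) 𝓘(ℝ, B) (fun q => Q.act q g) p (A.horizontalLift Z p)) ∧
      Q.base (A.horizontalLift Z) = Z) ∧
    -- the derivative that defines the Darboux–Lie derivative exists,
    -- and its value does not depend on the choice of a point in the fibre of `P`
    (∀ (x : M) (p : Q.Fiber x) (w : ⋀[ℝ]^k (TangentSpace 𝓘(ℝ, E) x)),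
      HasDerivAt (darbouxLieCurve (A.horizontalLift Z) (fun y => β.bundleMap y) p.1 ⟨x, w⟩)
        (Assoc.coord p (darbouxLie (A.horizontalLift Z) (fun y => β.bundleMap y) x w)) 0) ∧
    -- the Darboux–Lie derivative of `β` along `Z^H` is a `k`-form, namely `i_Z d^∇ β + d^∇ i_Z β`
    ∃ L : AssocForm Q ρ k,
      (∀ (x : M) (w : ⋀[ℝ]^k (TangentSpace 𝓘(ℝ, E) x)),
        darbouxLie (A.horizontalLift Z) (fun y => β.bundleMap y) x w = L.bundleMap x w) ∧
      ∀ (Y : Fin k → SmoothVF E M) (x : M),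
        L.toFun x (fun i => Y i x) = A.covLie Z β (fun i => Y i) x := by
  refine ⟨⟨A.smooth Z, fun p g => A.equivariant Z p g, A.base_horizontalLift Z⟩,
    fun x p w => A.hasDerivAt_darbouxLieCurve Z β p w, A.darbouxLieForm Z β, fun x w => ?_,
    fun Y x => ?_⟩
  · rw [AssocForm.bundleMap, PrincipalConnection.darbouxLieForm, LinearEquiv.apply_symm_apply]
    rfl
  · rw [A.covLie_eq_covLieFormula, ← A.darbouxLieLinear_ιMulti]
    exact exteriorPower.alternatingMapLinearEquiv_symm_apply _ _
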